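/- Let $\Bbbk$ be an algebraically closed field and let $\mathcal{C}$ be a unimodular ribbon category over $\Bbbk$: a $\Bbbk$-linear braided rigid monoidal category with bilinear tensor product, braiding $c$, dual $X^*$ with $\mathrm{ev}_X : X^* \otimes X \to \mathbb{1}$ and $\mathrm{coev}_X : \mathbb{1} \to X \otimes X^*$, and a twist, i.e. natural isomorphisms $\vartheta_X : X \to X$ with $\vartheta_{X \otimes Y} = (\vartheta_X \otimes \vartheta_Y) \circ c_{Y,X} \circ c_{X,Y}$ and $\vartheta_{X^*} = (\vartheta_X)^*$, such that $\mathcal{C}$ is linearly equivalent to the category of finite-dimensional left modules over a finite-dimensional $\Bbbk$-algebra, and such that the projective cover $P_{\mathbb{1}}$ of $\mathbb{1}$ satisfies $P_{\mathbb{1}}^* \cong P_{\mathbb{1}}$. Associativity and unit constraints, and the canonical isomorphisms $(X \otimes Y)^* \cong Y^* \otimes X^*$, $\mathbb{1}^* \cong \mathbb{1}$ and $X^{**} \cong X$ (the pivotal isomorphism determined by $\vartheta$), are suppressed. Then the end $\mathcal{E} = \int_{X \in \mathcal{C}} X \otimes X^*$ exists. Moreover, for every such end, with universal dinatural family $j_X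 : \mathcal{E} \to X \otimes X^*$, there are unique morphisms \[ \mu : \mathcal{E} \otimes \mathcal{E} \to \mathcal{E}, \quad \eta : \mathbb{1} \to \mathcal{E}, \quad \Delta : \mathcal{E} \to \mathcal{E} \otimes \mathcal{E}, \quad \varepsilon : \mathcal{E} \to \mathbb{1}, \quad S, S^{-1} : \mathcal{E} \to \mathcal{E}, \quad v_\pm : \mathbb{1} \to \mathcal{E}, \quad w_\pm : \mathbb{1} \to \mathcal{E} \otimes \mathcal{E} \] such that, for all $X, Y \in \mathcal{C}$, \begin{align*} j_X \circ \mu &= (\mathrm{id}_X \otimes \mathrm{ev}_X \otimes \mathrm{id}_{X^*}) \circ (j_X \otimes j_X), & j_X \circ \eta &= \mathrm{coev}_X, \\ (j_X \otimes j_Y) \circ \Delta &= (\mathrm{id}_X \otimes c_{Y \otimes Y^*,X^*}) \circ j_{X \otimes Y}, & \varepsilon &= j_{\mathbb{1}}, \\ j_X \circ S &= (\vartheta_X \otimes \mathrm{id}_{X^*}) \circ c_{X^*,X} \circ j_{X^*}, & j_X \circ S^{-1} &= (\vartheta_X^{-1} \otimes \mathrm{id}_{X^*}) \circ c_{X,X^*}^{-1}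 \circ j_{X^*}, \\ j_X \circ v_+ &= (\vartheta_X^{-1} \otimes \mathrm{id}_{X^*}) \circ \mathrm{coev}_X, & j_X \circ v_- &= (\vartheta_X \otimes \mathrm{id}_{X^*}) \circ \mathrm{coev}_X, \end{align*} \[ (j_X \otimes j_Y) \circ w_\pm = (\mathrm{id}_X \otimes (c_{Y,X^*} \circ c_{X^*,Y})^{\pm 1} \otimes \mathrm{id}_{Y^*}) \circ (\mathrm{coev}_X \otimes \mathrm{coev}_Y), \] and these morphisms make $\mathcal{E}$ into a BP-ribbon Hopf algebra in $\mathcal{C}$. That is, writing $c = c_{\mathcal{E},\mathcal{E}}$: \begin{itemize} \item[(0)] $(\mu,\eta,\Delta,\varepsilon,S)$ is a Hopf algebra in the braided category $\mathcal{C}$, $S^{-1}$ is inverse to $S$, and $w_+ = (\mu \otimes \mu) \circ (v_- \otimes (\Delta \circ v_+) \otimes v_-)$, $w_- = (\mu \otimes \mu) \circ (v_+ \otimes (c^{-1} \circ \Delta \circ v_-) \otimes v_+)$. \item[(i)] $v_+$ is central, invertible, normalized and antipode-invariant: $\mu \circ (v_+ \otimes \mathrm{id}) = \mu \circ (\mathrm{id}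 \otimes v_+)$, $\mu \circ (v_+ \otimes v_-) = \mu \circ (v_- \otimes v_+) = \eta$, $\varepsilon \circ v_+ = \mathrm{id}_{\mathbb{1}}$, $S \circ v_+ = v_+$. \item[(ii)] $w_+$ is a Hopf copairing: $(\Delta \otimes \mathrm{id}) \circ w_+ = (\mathrm{id} \otimes \mathrm{id} \otimes \mu) \circ (\mathrm{id} \otimes w_+ \otimes \mathrm{id}) \circ w_+$, $(\mathrm{id} \otimes \Delta) \circ w_+ = (\mu \otimes \mathrm{id} \otimes \mathrm{id}) \circ (\mathrm{id} \otimes w_+ \otimes \mathrm{id}) \circ w_+$, and $(\varepsilon \otimes \mathrm{id}) \circ w_+ = \eta = (\mathrm{id} \otimes \varepsilon) \circ w_+$. \item[(iii)] $v_+$ is compatible with the coproduct and $w_+$ with the braiding: with $\Omega := (\mu \otimes \mu) \circ (\mathrm{id} \otimes w_+ \otimes \mathrm{id})$ and with $\mu_2 := (\mu \otimes \mu) \circ (\mathrm{id} \otimes c \otimes \mathrm{id})$ the product of $\mathcal{E} \otimes \mathcal{E}$, \[ \Delta \circ \mu \circ (v_+ \otimes \mathrm{id}) = (\mu \otimes \mu)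 \circ (v_+ \otimes (\Omega \circ c^{-1} \circ \Delta) \otimes v_+), \qquad \Omega \circ c^{-1} \circ \Omega = \mu_2 \circ (\mu_2 \otimes \mathrm{id}_{\mathcal{E} \otimes \mathcal{E}}) \circ (w_+ \otimes c \otimes w_+). \] \end{itemize} -/

import Mathlib

open CategoryTheory MonoidalCategory Limits Opposite

universe w v u

/-! ### Finite, unimodular and ribbon categories -/

/-- A `k`-linear category is *finite* if it is equivalent, as a `k`-linear category, to the
category of finite-dimensional left modules over a finite-dimensional `k`-algebra `A`
(over such an `A`, finite-dimensional and finitely generated modules coincide). -/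
def IsFiniteLinearCategory (k : Type w) [Field k] (C : Type u) [Category.{v} C] [Preadditive C]
    [Linear k C] : Prop :=
  ∃ (A : Type w) (_ : Ring A) (_ : Algebra k A) (e : C ≌ FGModuleCat.{w} A)
    (_ : e.functor.Additive), FiniteDimensional k A ∧ e.functor.Linear k

/-- `p : P ⟶ X` is a projective cover: `P` is projective and `p` is an essential epimorphism. -/
structure IsProjectiveCover {C : Type u} [Category.{v} C] {P X : C} (p : P ⟶ X) : Prop where
  projective : Projective P
  epi : Epi p
  essential : ∀ {Q : C} (g : Q ⟶ P), Epi (g ≫ p) → Epi g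

/-- A rigid linear monoidal category is *unimodular* if it is finite and the projective cover of
the tensor unit is isomorphic to its own dual. -/
structure IsUnimodularCategory (k : Type w) [Field k] (C : Type u) [Category.{v} C]
    [Preadditive C] [Linear k C] [MonoidalCategory C] [RigidCategory C] : Prop where
  finite : IsFiniteLinearCategory k C
  selfDual : ∃ (P : C) (p : P ⟶ 𝟙_ C), IsProjectiveCover p ∧ Nonempty (Pᘁ ≅ P)

/-- A ribbon structure (twist) on a braided rigid monoidal category. The dual `X*` is Mathlib's
`Xᘁ`, with evaluation `Xᘁ ⊗ X ⟶ 𝟙_ C` and coevaluation `𝟙_ C ⟶ X ⊗ Xᘁ`. -/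
class RibbonCategory (C : Type u) [Category.{v} C] [MonoidalCategory C] [BraidedCategory C]
    [RigidCategory C] where
  /-- the twist isomorphisms -/
  twist : ∀ X : C, X ≅ X
  twist_naturality : ∀ {X Y : C} (f : X ⟶ Y), f ≫ (twist Y).hom = (twist X).hom ≫ f
  twist_tensor : ∀ X Y : C,
    (twist (X ⊗ Y)).hom = (β_ X Y).hom ≫ (β_ Y X).hom ≫ ((twist X).hom ⊗ₘ (twist Y).hom)
  twist_dual : ∀ X : C, (twist (Xᘁ)).hom = ((twist X).hom)ᘁ

/-! ### BP-ribbon Hopf algebras in a braided monoidal category -/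

section BPRibbon

variable {C : Type u} [Category.{v} C] [MonoidalCategory C]

/-- The structure morphisms of a BP-ribbon Hopf algebra. -/
@[ext]
structure BPRibbonData (H : C) where
  /-- the product -/
  mul : H ⊗ H ⟶ H
  /-- the unit -/
  one : 𝟙_ C ⟶ H
  /-- the coproduct -/
  comul : H ⟶ H ⊗ H
  /-- the counit -/
  counit : H ⟶ 𝟙_ C
  /-- the antipode -/
  antipode : H ⟶ H
  /-- the inverse antipode -/
  antipodeInv : H ⟶ H
  /-- the ribbon element `v₊` -/
  ribbon : 𝟙_ C ⟶ H
  /-- the inverse ribbon element `v₋` -/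
  ribbonInv : 𝟙_ C ⟶ H
  /-- the copairing `w₊` -/
  copairing : 𝟙_ C ⟶ H ⊗ H
  /-- the negative copairing `w₋` -/
  copairingNeg : 𝟙_ C ⟶ H ⊗ H

namespace BPRibbonData

variable {H : C} (D : BPRibbonData H)

/-- Left multiplication `x ↦ a x` by an element `a : 𝟙_ C ⟶ H`. -/
def leftMul (a : 𝟙_ C ⟶ H) : H ⟶ H := (λ_ H).inv ≫ a ▷ H ≫ D.mul

/-- Right multiplication `x ↦ x a` by an element `a : 𝟙_ C ⟶ H`. -/
def rightMul (a : 𝟙_ C ⟶ H) : H ⟶ H := (ρ_ H).inv ≫ H ◁ a ≫ D.mul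

/-- Insertion of `w₊` between two factors, `x ⊗ y ↦ x ⊗ w₊ ⊗ y`. -/
def insertCopairing : H ⊗ H ⟶ H ⊗ ((H ⊗ H) ⊗ H) :=
  H ◁ ((λ_ H).inv ≫ D.copairing ▷ H)

/-- The morphism `(μ ⊗ μ) ∘ (id ⊗ w₊ ⊗ id) : H ⊗ H ⟶ H ⊗ H`. -/
def innerCopairing : H ⊗ H ⟶ H ⊗ H :=
  D.insertCopairing ≫ H ◁ (α_ H H H).hom ≫ (α_ H H (H ⊗ H)).inv ≫ (D.mul ⊗ₘ D.mul)

variable [BraidedCategory C]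

/-- The product `(μ ⊗ μ) ∘ (id ⊗ c ⊗ id)` of the braided tensor product algebra `H ⊗ H`. -/
def mulTensor : (H ⊗ H) ⊗ (H ⊗ H) ⟶ H ⊗ H :=
  tensorμ H H H H ≫ (D.mul ⊗ₘ D.mul)

/-- The structure morphisms `D` make `H` into a BP-ribbon Hopf algebra. -/
structure IsBPRibbonHopf : Prop where
  /-- `H` is a Hopf algebra in the braided category `C` ... -/
  hopf : ∃ h : HopfObj H, h.mul = D.mul ∧ h.one = D.one ∧ h.comul = D.comul ∧
    h.counit = D.counit ∧ h.antipode = D.antipode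
  /-- ... with invertible antipode. -/
  antipode_antipodeInv : D.antipode ≫ D.antipodeInv = 𝟙 H
  antipodeInv_antipode : D.antipodeInv ≫ D.antipode = 𝟙 H
  /-- `w₊ = (μ ⊗ μ) ∘ (v₋ ⊗ (Δ ∘ v₊) ⊗ v₋)` -/
  copairing_eq : D.copairing =
    D.ribbon ≫ D.comul ≫ (D.leftMul D.ribbonInv ⊗ₘ D.rightMul D.ribbonInv)
  /-- `w₋ = (μ ⊗ μ) ∘ (v₊ ⊗ (c⁻¹ ∘ Δ ∘ v₋) ⊗ v₊)` -/
  copairingNeg_eq : D.copairingNeg =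
    D.ribbonInv ≫ D.comul ≫ (β_ H H).inv ≫ (D.leftMul D.ribbon ⊗ₘ D.rightMul D.ribbon)
  /-- (i) `v₊` is central, -/
  ribbon_central : D.leftMul D.ribbon = D.rightMul D.ribbon
  /-- invertible with inverse `v₋`, -/
  ribbon_ribbonInv : D.ribbonInv ≫ D.leftMul D.ribbon = D.one
  ribbonInv_ribbon : D.ribbon ≫ D.leftMul D.ribbonInv = D.one
  /-- normalized -/
  ribbon_counit : D.ribbon ≫ D.counit = 𝟙 (𝟙_ C)
  /-- and antipode-invariant. -/
  ribbon_antipode : D.ribbon ≫ D.antipode = D.ribbon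
  /-- (ii) `w₊` is a Hopf copairing:
  `(Δ ⊗ id) ∘ w₊ = (id ⊗ id ⊗ μ) ∘ (id ⊗ w₊ ⊗ id) ∘ w₊`, -/
  copairing_comul_left : D.copairing ≫ D.comul ▷ H =
    D.copairing ≫ D.insertCopairing ≫ H ◁ (α_ H H H).hom ≫ (α_ H H (H ⊗ H)).inv ≫
      (H ⊗ H) ◁ D.mul
  /-- `(id ⊗ Δ) ∘ w₊ = (μ ⊗ id ⊗ id) ∘ (id ⊗ w₊ ⊗ id) ∘ w₊`, -/
  copairing_comul_right : D.copairing ≫ H ◁ D.comul =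
    D.copairing ≫ D.insertCopairing ≫ H ◁ (α_ H H H).hom ≫ (α_ H H (H ⊗ H)).inv ≫
      D.mul ▷ (H ⊗ H)
  /-- `(ε ⊗ id) ∘ w₊ = η = (id ⊗ ε) ∘ w₊`. -/
  copairing_counit_left : D.copairing ≫ D.counit ▷ H ≫ (λ_ H).hom = D.one
  copairing_counit_right : D.copairing ≫ H ◁ D.counit ≫ (ρ_ H).hom = D.one
  /-- (iii) `v₊` is compatible with the coproduct: `Δ(v₊ x)` is obtained from `c⁻¹(Δ(x))` by
  inserting `w₊` and multiplying by `v₊` on both sides, -/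
  ribbon_comul : D.leftMul D.ribbon ≫ D.comul =
    D.comul ≫ (β_ H H).inv ≫ D.innerCopairing ≫ (D.leftMul D.ribbon ⊗ₘ D.rightMul D.ribbon)
  /-- and `w₊` with the braiding: the right-hand side is `x ⊗ y ↦ w₊ · c(x ⊗ y) · w₊`, the
  products being taken in the braided tensor product algebra `H ⊗ H`. -/
  copairing_braiding : D.innerCopairing ≫ (β_ H H).inv ≫ D.innerCopairing =
    (β_ H H).hom ≫
      ((λ_ (H ⊗ H)).inv ≫ D.copairing ▷ (H ⊗ H) ≫ D.mulTensor) ≫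
      ((ρ_ (H ⊗ H)).inv ≫ (H ⊗ H) ◁ D.copairing ≫ D.mulTensor)

end BPRibbonData

end BPRibbon

/-! ### The end of `X ⊗ X*` and its structure morphisms -/

section End

/-- The contravariant functor `X ↦ X*`, `f ↦ f*`. -/
@[simps]
def dualFunctor (C : Type u) [Category.{v} C] [MonoidalCategory C] [RigidCategory C] :
    Cᵒᵖ ⥤ C where
  obj X := (unop X)ᘁ
  map f := (f.unop)ᘁ
  map_id X := by simp
  map_comp f g := by simp [comp_rightAdjointMate]

/-- The functor `(Y, X) ↦ X ⊗ Y*`, whose end is `∫_X X ⊗ X*`. -/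
abbrev tensorDualFunctor (C : Type u) [Category.{v} C] [MonoidalCategory C] [RigidCategory C] :
    Cᵒᵖ ⥤ C ⥤ C :=
  dualFunctor C ⋙ tensoringRight C

variable {C : Type u} [Category.{v} C] [MonoidalCategory C] [RigidCategory C]

/-- The structure morphisms `j_X : E ⟶ X ⊗ X*` of a wedge for `(Y, X) ↦ X ⊗ Y*`. -/
def wedgeProj (W : Wedge (tensorDualFunctor C)) (X : C) : W.pt ⟶ X ⊗ Xᘁ := W.ι X

/-- The left evaluation `X* ⊗ X ⟶ 𝟙`. -/
def leftEv (X : C) : Xᘁ ⊗ X ⟶ 𝟙_ C := ε_ X Xᘁ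

/-- The left coevaluation `𝟙 ⟶ X ⊗ X*`. -/
def leftCoev (X : C) : 𝟙_ C ⟶ X ⊗ Xᘁ := η_ X Xᘁ

/-- The canonical isomorphism `(X ⊗ Y)* ≅ Y* ⊗ X*`. -/
def dualTensorIso (X Y : C) : (X ⊗ Y)ᘁ ≅ Yᘁ ⊗ Xᘁ := rightDualTensorIso X Y

variable [BraidedCategory C] [RibbonCategory C]

open RibbonCategory

/-- The right coevaluation `𝟙 ⟶ X* ⊗ X` determined by the ribbon structure. -/
def rightCoev (X : C) : 𝟙_ C ⟶ Xᘁ ⊗ X :=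
  leftCoev X ≫ (β_ X Xᘁ).hom ≫ Xᘁ ◁ (twist X).hom

/-- The inverse `X** ⟶ X` of the pivotal isomorphism determined by the ribbon structure. -/
def pivotalInv (X : C) : ((Xᘁ : C)ᘁ : C) ⟶ X :=
  (ρ_ _).inv ≫ ((Xᘁ : C)ᘁ : C) ◁ rightCoev X ≫ (α_ _ (Xᘁ) X).inv ≫ leftEv (Xᘁ : C) ▷ X ≫
    (λ_ X).hom

/-- The diagrammatic definition of the structure morphisms of the end `E`, through their
composition with the structure morphisms `j_X : E ⟶ X ⊗ X*`. The symbol `⊗≫` is composition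
with the canonical associativity and unit constraints inserted. -/
structure IsEndStructure {E : C} (j : ∀ X : C, E ⟶ X ⊗ Xᘁ) (D : BPRibbonData E) : Prop where
  /-- `j_X ∘ μ = (id ⊗ ev_X ⊗ id) ∘ (j_X ⊗ j_X)` -/
  mul : ∀ X : C, D.mul ≫ j X = (j X ⊗ₘ j X) ⊗≫ X ◁ (leftEv X ▷ Xᘁ) ⊗≫ 𝟙 (X ⊗ Xᘁ)
  /-- `j_X ∘ η = coev_X` -/
  one : ∀ X : C, D.one ≫ j X = leftCoev X
  /-- `(j_X ⊗ j_Y) ∘ Δ` is `j_{X ⊗ Y}`, followed by moving `X*` to the left of `Y ⊗ Y*`. -/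
  comul : ∀ X Y : C, D.comul ≫ (j X ⊗ₘ j Y) =
    j (X ⊗ Y) ⊗≫ (X ⊗ Y) ◁ (dualTensorIso X Y).hom ⊗≫ X ◁ (β_ (Y ⊗ Yᘁ) (Xᘁ)).hom ⊗≫
      𝟙 ((X ⊗ Xᘁ) ⊗ (Y ⊗ Yᘁ))
  /-- `ε = j_𝟙`, under `𝟙 ⊗ 𝟙* ≅ 𝟙* ≅ 𝟙* ⊗ 𝟙 ≅ 𝟙` -/
  counit : D.counit = j (𝟙_ C) ≫ (λ_ _).hom ≫ (ρ_ _).inv ≫ leftEv (𝟙_ C)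
  /-- `j_X ∘ S = (θ_X ⊗ id) ∘ c_{X*,X} ∘ j_{X*}`, where `X** = X` -/
  antipode : ∀ X : C, D.antipode ≫ j X =
    j (Xᘁ) ≫ Xᘁ ◁ pivotalInv X ≫ (β_ (Xᘁ) X).hom ≫ (twist X).hom ▷ Xᘁ
  /-- `j_X ∘ S⁻¹ = (θ_X⁻¹ ⊗ id) ∘ c_{X,X*}⁻¹ ∘ j_{X*}`, where `X** = X` -/
  antipodeInv : ∀ X : C, D.antipodeInv ≫ j X =
    j (Xᘁ) ≫ Xᘁ ◁ pivotalInv X ≫ (β_ X (Xᘁ)).inv ≫ (twist X).inv ▷ Xᘁ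
  /-- `j_X ∘ v₊ = (θ_X⁻¹ ⊗ id) ∘ coev_X` -/
  ribbon : ∀ X : C, D.ribbon ≫ j X = leftCoev X ≫ (twist X).inv ▷ Xᘁ
  /-- `j_X ∘ v₋ = (θ_X ⊗ id) ∘ coev_X` -/
  ribbonInv : ∀ X : C, D.ribbonInv ≫ j X = leftCoev X ≫ (twist X).hom ▷ Xᘁ
  /-- `(j_X ⊗ j_Y) ∘ w₊ = (id ⊗ (c_{Y,X*} ∘ c_{X*,Y}) ⊗ id) ∘ (coev_X ⊗ coev_Y)` -/
  copairing : ∀ X Y : C, D.copairing ≫ (j X ⊗ₘ j Y) =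
    𝟙 (𝟙_ C) ⊗≫ (leftCoev X ⊗ₘ leftCoev Y) ⊗≫
      X ◁ (((β_ (Xᘁ) Y).hom ≫ (β_ Y (Xᘁ)).hom) ▷ Yᘁ) ⊗≫ 𝟙 ((X ⊗ Xᘁ) ⊗ (Y ⊗ Yᘁ))
  /-- `(j_X ⊗ j_Y) ∘ w₋ = (id ⊗ (c_{Y,X*} ∘ c_{X*,Y})⁻¹ ⊗ id) ∘ (coev_X ⊗ coev_Y)` -/
  copairingNeg : ∀ X Y : C, D.copairingNeg ≫ (j X ⊗ₘ j Y) =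
    𝟙 (𝟙_ C) ⊗≫ (leftCoev X ⊗ₘ leftCoev Y) ⊗≫
      X ◁ (((β_ Y (Xᘁ)).inv ≫ (β_ (Xᘁ) Y).inv) ▷ Yᘁ) ⊗≫ 𝟙 ((X ⊗ Xᘁ) ⊗ (Y ⊗ Yᘁ))

end End

/-!
By the adjunction `E ⊗ X ⟶ X ↔ E ⟶ X ⊗ Xᘁ`, a wedge over `X ⊗ Xᘁ` is a natural family of actions
`E ⊗ X ⟶ X`, and the end represents `Z ↦ Nat(Z ⊗ -, 𝟭)`: a morphism into `E` is determined by its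
action on every `X`, and a morphism into `E ⊗ E` by its action on every `X ⊗ Y`. In these terms `μ`
acts by composition, `Δ` by the action on a tensor product, `v₊` by the inverse twist and `w₊` by
the inverse double braiding, so each axiom becomes an identity between natural transformations of
`X` and `Y`. Existence reduces to a joint equalizer inside `P ⊗ Pᘁ`: the image `P` of the regular
module is dense, so a natural transformation is determined by its component at `P`, which may be
any map compatible with the endomorphisms of `P`.
-/

/-! ### Wedges and universal actions -/

section UniversalAction

variable {C : Type u} [Category.{v} C] [MonoidalCategory C]

/-- A family of morphisms `E ⊗ X ⟶ X`, natural in `X` and universal among all such families: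
`E` represents the functor `Z ↦ Nat(Z ⊗ -, 𝟭)`. -/
structure IsUniversalAction {E : C} (a : ∀ X : C, E ⊗ X ⟶ X) : Prop where
  naturality : ∀ {X Y : C} (f : X ⟶ Y), E ◁ f ≫ a Y = a X ≫ f
  exists_lift : ∀ {Z : C} (t : ∀ X : C, Z ⊗ X ⟶ X),
    (∀ {X Y : C} (f : X ⟶ Y), Z ◁ f ≫ t Y = t X ≫ f) → ∃ f : Z ⟶ E, ∀ X, f ▷ X ≫ a X = t X
  hom_ext : ∀ {Z : C} {f g : Z ⟶ E}, (∀ X, f ▷ X ≫ a X = g ▷ X ≫ a X) → f = g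

variable [RigidCategory C]

/-- The adjunction bijection between morphisms `Z ⟶ Y ⊗ X*` and `Z ⊗ X ⟶ Y`. -/
def uncurryDual {Z X Y : C} : (Z ⟶ Y ⊗ Xᘁ) ≃ (Z ⊗ X ⟶ Y) :=
  (tensorRightHomEquiv Z X Xᘁ Y).symm

lemma uncurryDual_apply {Z X Y : C} (f : Z ⟶ Y ⊗ Xᘁ) :
    uncurryDual f = f ▷ X ≫ (α_ _ _ _).hom ≫ Y ◁ leftEv X ≫ (ρ_ _).hom := rfl

lemma uncurryDual_comp {Z Z' X Y : C} (g : Z' ⟶ Z) (f : Z ⟶ Y ⊗ Xᘁ) :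
    uncurryDual (g ≫ f) = g ▷ X ≫ uncurryDual f :=
  tensorRightHomEquiv_symm_naturality g f

lemma uncurryDual_comp_whiskerRight {Z X Y Y' : C} (f : Z ⟶ Y ⊗ Xᘁ) (g : Y ⟶ Y') :
    uncurryDual (f ≫ g ▷ Xᘁ) = uncurryDual f ≫ g := by
  rw [← Equiv.eq_symm_apply]
  exact (congrArg (· ≫ g ▷ Xᘁ) ((tensorRightHomEquiv Z X Xᘁ Y).apply_symm_apply f)).symm.trans
    (tensorRightHomEquiv_naturality _ g).symm

lemma rightAdjointMate_comp_leftEv {X Y : C} (f : X ⟶ Y) :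
    fᘁ ▷ X ≫ leftEv X = Yᘁ ◁ f ≫ leftEv Y :=
  rightAdjointMate_comp_evaluation f

lemma uncurryDual_comp_whiskerLeft_rightAdjointMate {Z X Y W : C} (f : Z ⟶ W ⊗ Yᘁ) (g : X ⟶ Y) :
    uncurryDual (f ≫ W ◁ gᘁ) = Z ◁ g ≫ uncurryDual f := by
  simp only [uncurryDual_apply, comp_whiskerRight, Category.assoc, whisker_assoc,
    Iso.inv_hom_id_assoc]
  rw [← whiskerLeft_comp_assoc, rightAdjointMate_comp_leftEv, whisker_exchange_assoc]
  simp only [whiskerLeft_comp, Category.assoc, tensor_whiskerLeft, Iso.inv_hom_id_assoc]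

lemma dinatural_iff_natural {Z X Y : C} (s : Z ⟶ X ⊗ Xᘁ) (t : Z ⟶ Y ⊗ Yᘁ) (f : X ⟶ Y) :
    s ≫ f ▷ Xᘁ = t ≫ Y ◁ fᘁ ↔ Z ◁ f ≫ uncurryDual t = uncurryDual s ≫ f := by
  rw [← uncurryDual_comp_whiskerRight, ← uncurryDual_comp_whiskerLeft_rightAdjointMate,
    uncurryDual.injective.eq_iff, eq_comm]

lemma uncurryDual_leftCoev (X : C) : uncurryDual (leftCoev X) = (λ_ X).hom := by
  simp [uncurryDual_apply, leftCoev, leftEv]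

/-- The action `E ⊗ X ⟶ X` adjoint to the structure morphism `E ⟶ X ⊗ X*` of a wedge. -/
def wedgeAct (W : Wedge (tensorDualFunctor C)) (X : C) : W.pt ⊗ X ⟶ X :=
  uncurryDual (wedgeProj W X)

lemma wedgeProj_condition (W : Wedge (tensorDualFunctor C)) {X Y : C} (f : X ⟶ Y) :
    wedgeProj W X ≫ f ▷ Xᘁ = wedgeProj W Y ≫ Y ◁ fᘁ :=
  Wedge.condition W f

lemma wedgeAct_naturality (W : Wedge (tensorDualFunctor C)) {X Y : C} (f : X ⟶ Y) :
    W.pt ◁ f ≫ wedgeAct W Y = wedgeAct W X ≫ f :=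
  (dinatural_iff_natural _ _ f).1 (wedgeProj_condition W f)

lemma exists_wedgeProj_lift {W : Wedge (tensorDualFunctor C)} (hW : IsLimit W) {Z : C}
    (t : ∀ X : C, Z ⟶ X ⊗ Xᘁ)
    (ht : ∀ {X Y : C} (f : X ⟶ Y), t X ≫ f ▷ Xᘁ = t Y ≫ Y ◁ fᘁ) :
    ∃ s : Z ⟶ W.pt, ∀ X, s ≫ wedgeProj W X = t X :=
  ⟨Wedge.IsLimit.lift hW t fun _ _ f => ht f, fun X => Wedge.IsLimit.lift_ι hW t _ X⟩

lemma wedgeProj_hom_ext {W : Wedge (tensorDualFunctor C)} (hW : IsLimit W) {Z : C}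
    {f g : Z ⟶ W.pt} (h : ∀ X, f ≫ wedgeProj W X = g ≫ wedgeProj W X) : f = g :=
  Wedge.IsLimit.hom_ext hW h

lemma isUniversalAction_wedgeAct {W : Wedge (tensorDualFunctor C)} (hW : IsLimit W) :
    IsUniversalAction (wedgeAct W) where
  naturality := wedgeAct_naturality W
  exists_lift {Z} t ht := by
    obtain ⟨s, hs⟩ := exists_wedgeProj_lift hW (fun X => uncurryDual.symm (t X)) fun f => by
      rw [dinatural_iff_natural, Equiv.apply_symm_apply, Equiv.apply_symm_apply, ht]
    exact ⟨s, fun X => by rw [wedgeAct, ← uncurryDual_comp, hs, Equiv.apply_symm_apply]⟩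
  hom_ext h := wedgeProj_hom_ext hW fun X => uncurryDual.injective <| by
    rw [uncurryDual_comp, uncurryDual_comp]; exact h X

lemma IsUniversalAction.hasEnd {E : C} {a : ∀ X : C, E ⊗ X ⟶ X} (ha : IsUniversalAction a) :
    HasEnd (tensorDualFunctor C) := by
  let j (X : C) : E ⟶ X ⊗ Xᘁ := uncurryDual.symm (a X)
  have comp_j {Z : C} (f : Z ⟶ E) (X : C) : uncurryDual (f ≫ j X) = f ▷ X ≫ a X := by
    rw [uncurryDual_comp, Equiv.apply_symm_apply]
  let W : Wedge (tensorDualFunctor C) := Wedge.mk E j fun X Y f =>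
    (dinatural_iff_natural (j X) (j Y) f).2 <| by
      simp only [j, Equiv.apply_symm_apply, ha.naturality]
  have exists_lift (s : Wedge (tensorDualFunctor C)) : ∃ f : s.pt ⟶ E, ∀ X, f ≫ j X = s.ι X := by
    obtain ⟨f, hf⟩ := ha.exists_lift (wedgeAct s) (wedgeAct_naturality s)
    exact ⟨f, fun X => uncurryDual.injective ((comp_j f X).trans (hf X))⟩
  choose lift hlift using exists_lift
  refine ⟨⟨⟨W, Multifork.IsLimit.mk W lift hlift fun s (m : s.pt ⟶ E) hm => ?_⟩⟩⟩
  refine ha.hom_ext fun X => ?_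
  rw [← comp_j, ← comp_j, hlift]
  exact congrArg _ (hm X)

end UniversalAction

/-! ### Existence of the universal action in a finite category -/

section DenseGenerator

universe v₁ u₁ v₂ u₂

/-- `P` is a *dense generator* of a preadditive category if morphisms `X ⟶ V` are the same as
additive `End P`-equivariant maps `Hom(P, X) → Hom(P, V)`. -/
structure IsDenseGenerator {C : Type u} [Category.{v} C] [Preadditive C] (P : C) : Prop where
  exists_hom : ∀ {X V : C} (h : (P ⟶ X) → (P ⟶ V)), (∀ p q, h (p + q) = h p + h q) →
    (∀ (s : P ⟶ P) (p : P ⟶ X), h (s ≫ p) = s ≫ h p) → ∃ f : X ⟶ V, ∀ p, h p = p ≫ f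
  hom_ext : ∀ {X V : C} {f g : X ⟶ V}, (∀ p : P ⟶ X, p ≫ f = p ≫ g) → f = g

lemma isDenseGenerator_FGModuleCat_of_self (A : Type w) [Ring A] :
    IsDenseGenerator (FGModuleCat.of A A) := by
  let elt {X : FGModuleCat.{w} A} (x : X) : FGModuleCat.of A A ⟶ X :=
    FGModuleCat.ofHom (LinearMap.toSpanSingleton A X x)
  have elt_comp {X V : FGModuleCat.{w} A} (x : X) (f : X ⟶ V) :
      elt x ≫ f = elt (f.hom.hom x) := by
    ext
    exact f.hom.hom.map_smul 1 x
  have elt_apply {X : FGModuleCat.{w} A} (p : FGModuleCat.of A A ⟶ X) :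
      elt (p.hom.hom (1 : A)) = p := by
    ext
    exact one_smul A _
  have elt_one {X : FGModuleCat.{w} A} (x : X) : (elt x).hom.hom (1 : A) = x := one_smul A x
  have elt_injective {X : FGModuleCat.{w} A} {x y : X} (h : elt x = elt y) : x = y := by
    rw [← elt_one x, h, elt_one]
  have elt_add {X : FGModuleCat.{w} A} (x y : X) : elt (x + y) = elt x + elt y := by
    ext
    exact smul_add (1 : A) x y
  have elt_smul {X : FGModuleCat.{w} A} (b : A) (x : X) : elt (b • x) = elt b ≫ elt x :=
    (elt_comp (X := FGModuleCat.of A A) b (elt x)).symm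
  refine ⟨fun {X V} h h_add h_comp => ?_, fun {X V f g} h => ?_⟩
  · let φ : X →ₗ[A] V :=
      { toFun := fun x => (h (elt x)).hom.hom (1 : A)
        map_add' := fun x y => elt_injective <| by
          rw [elt_apply, elt_add, h_add, elt_add, elt_apply, elt_apply]
        map_smul' := fun b x => elt_injective <| by
          rw [elt_apply, elt_smul, h_comp, RingHom.id_apply, elt_smul, elt_apply] }
    refine ⟨FGModuleCat.ofHom φ, fun p => ?_⟩
    rw [← elt_apply p, elt_comp]
    exact (elt_apply _).symm
  · ext x
    exact elt_injective <| by
      have := h (elt x)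
      rwa [elt_comp, elt_comp] at this

variable {C : Type u₁} [Category.{v₁} C] [Preadditive C] {D : Type u₂} [Category.{v₂} D]

namespace IsDenseGenerator

variable {P : C} {L : C ⥤ D} {R : D ⥤ C} (adj : L ⊣ R)

include adj

lemma map_hom_ext (hP : IsDenseGenerator P) {X : C} {V : D} {f g : L.obj X ⟶ V}
    (h : ∀ p : P ⟶ X, L.map p ≫ f = L.map p ≫ g) : f = g :=
  (adj.homEquiv X V).injective <| hP.hom_ext fun p => by
    rw [← adj.homEquiv_naturality_left, ← adj.homEquiv_naturality_left, h]

variable [Preadditive D]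

lemma of_adjunction [R.Full] [R.Faithful] [R.Additive] (hP : IsDenseGenerator P) :
    IsDenseGenerator (L.obj P) := by
  refine ⟨fun {X V} h h_add h_comp => ?_, fun {X V f g} h => R.map_injective <|
    hP.hom_ext fun p => ?_⟩
  · have symm_add (p q : P ⟶ R.obj X) : (adj.homEquiv P X).symm (p + q) =
        (adj.homEquiv P X).symm p + (adj.homEquiv P X).symm q :=
      have := adj.left_adjoint_additive
      map_add (adj.homAddEquiv P X).symm p q
    have equiv_add (p q : L.obj P ⟶ V) : adj.homEquiv P V (p + q) =
        adj.homEquiv P V p + adj.homEquiv P V q :=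
      have := adj.left_adjoint_additive
      map_add (adj.homAddEquiv P V) p q
    obtain ⟨f, hf⟩ := hP.exists_hom
      (fun p : P ⟶ R.obj X => adj.homEquiv P V (h ((adj.homEquiv P X).symm p)))
      (fun p q => by rw [symm_add, h_add, equiv_add])
      (fun s p => by rw [adj.homEquiv_naturality_left_symm, h_comp, adj.homEquiv_naturality_left])
    refine ⟨R.preimage f, fun p => (adj.homEquiv P V).injective ?_⟩
    rw [adj.homEquiv_naturality_right, R.map_preimage, ← hf, Equiv.symm_apply_apply]
  · apply (adj.homEquiv P V).symm.injective
    rw [adj.homEquiv_naturality_right_symm, adj.homEquiv_naturality_right_symm, h]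

lemma exists_map_hom [L.Additive] (hP : IsDenseGenerator P) {X : C} {V : D}
    (h : (P ⟶ X) → (L.obj P ⟶ V)) (h_add : ∀ p q, h (p + q) = h p + h q)
    (h_comp : ∀ (s : P ⟶ P) (p : P ⟶ X), h (s ≫ p) = L.map s ≫ h p) :
    ∃ f : L.obj X ⟶ V, ∀ p, h p = L.map p ≫ f := by
  obtain ⟨f, hf⟩ := hP.exists_hom (fun p => adj.homEquiv P V (h p))
    (fun p q => (congrArg _ (h_add p q)).trans (map_add (adj.homAddEquiv P V) _ _))
    (fun s p => by rw [h_comp, adj.homEquiv_naturality_left])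
  refine ⟨(adj.homEquiv X V).symm f, fun p => (adj.homEquiv P V).injective ?_⟩
  rw [hf, adj.homEquiv_naturality_left, Equiv.apply_symm_apply]

end IsDenseGenerator

end DenseGenerator

section JointEqualizers

universe t v₁ u₁ v₂ u₂

/-- `C` has *joint equalizers*: every family of parallel pairs `Q ⇉ V` has a largest subobject of
`Q` on which all of the pairs agree. -/
def HasJointEqualizers.{t', v', u'} (C : Type u') [Category.{v'} C] : Prop :=
  ∀ ⦃ι : Type t'⦄ ⦃Q V : C⦄ (g g' : ι → (Q ⟶ V)), ∃ (K : C) (κ : K ⟶ Q), Mono κ ∧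
    ∀ {Z : C} (z : Z ⟶ Q), (∀ i, z ≫ g i = z ≫ g' i) ↔ ∃ y, y ≫ κ = z

lemma hasJointEqualizers_FGModuleCat (A : Type w) [Ring A] [IsNoetherianRing A] :
    HasJointEqualizers.{t} (FGModuleCat.{w} A) := by
  intro ι Q V g g'
  let N : Submodule A Q := ⨅ i, LinearMap.eqLocus (g i).hom.hom (g' i).hom.hom
  have mem_N (y : Q) : y ∈ N ↔ ∀ i, (g i).hom.hom y = (g' i).hom.hom y := by
    simp only [N, Submodule.mem_iInf, LinearMap.mem_eqLocus]
  have forall_iff_range_le {Z : FGModuleCat.{w} A} (z : Z ⟶ Q) :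
      (∀ i, z ≫ g i = z ≫ g' i) ↔ ∀ x, z.hom.hom x ∈ N := by
    simp only [mem_N]
    exact ⟨fun h x i => congr($(h i).hom.hom x), fun h i => by ext x; exact h x i⟩
  let κ : FGModuleCat.of A N ⟶ Q := ObjectProperty.homMk (ModuleCat.ofHom N.subtype)
  refine ⟨FGModuleCat.of A N, κ, ⟨fun {Z} s t h => ?_⟩, fun {Z} z => ?_⟩
  · ext x
    exact congr($(h).hom.hom x)
  · rw [forall_iff_range_le]
    constructor
    · exact fun h => ⟨ObjectProperty.homMk (ModuleCat.ofHom (z.hom.hom.codRestrict N h)), rfl⟩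
    · rintro ⟨y, rfl⟩ x
      exact (y.hom.hom x).2

lemma HasJointEqualizers.of_equivalence {C : Type u₁} [Category.{v₁} C] {D : Type u₂}
    [Category.{v₂} D] (e : C ≌ D) (hD : HasJointEqualizers.{t} D) :
    HasJointEqualizers.{t} C := by
  intro ι Q V g g'
  obtain ⟨K, κ, _, hκ⟩ := hD (fun i => e.functor.map (g i)) (fun i => e.functor.map (g' i))
  let i := e.counitIso.app K
  obtain ⟨κ', hκ'⟩ := e.functor.map_surjective (i.hom ≫ κ)
  have : Mono (e.functor.map κ') := by rw [hκ']; infer_instance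
  refine ⟨e.inverse.obj K, κ', e.functor.mono_of_mono_map this, fun {Z} z => ?_⟩
  have comp_iff (j : ι) : e.functor.map z ≫ e.functor.map (g j) =
      e.functor.map z ≫ e.functor.map (g' j) ↔ z ≫ g j = z ≫ g' j := by
    rw [← e.functor.map_comp, ← e.functor.map_comp, e.functor.map_injective.eq_iff]
  simp only [← comp_iff, hκ]
  constructor
  · rintro ⟨y, hy⟩
    refine ⟨e.functor.preimage (y ≫ i.inv), e.functor.map_injective ?_⟩
    rw [e.functor.map_comp, e.functor.map_preimage, hκ', Category.assoc, i.inv_hom_id_assoc, hy]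
  · rintro ⟨y, rfl⟩
    exact ⟨e.functor.map y ≫ i.hom, by rw [e.functor.map_comp, hκ', Category.assoc]⟩

end JointEqualizers

namespace IsFiniteLinearCategory

universe t

variable {k : Type w} [Field k] {C : Type u} [Category.{v} C] [Preadditive C] [Linear k C]

lemma exists_isDenseGenerator (hC : IsFiniteLinearCategory k C) :
    ∃ P : C, IsDenseGenerator P := by
  obtain ⟨A, _, _, e, _, _, _⟩ := hC
  have : e.symm.inverse.Additive := inferInstanceAs e.functor.Additive
  exact ⟨_, (isDenseGenerator_FGModuleCat_of_self A).of_adjunction e.symm.toAdjunction⟩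

lemma hasJointEqualizers (hC : IsFiniteLinearCategory k C) : HasJointEqualizers.{t} C := by
  obtain ⟨A, _, _, e, _, _, _⟩ := hC
  have : IsNoetherianRing A := isNoetherian_of_tower k inferInstance
  exact .of_equivalence e (hasJointEqualizers_FGModuleCat A)

end IsFiniteLinearCategory

/-- The object of endomorphism-invariants in `P ⊗ P*` is the end, and acts on `X` through the
morphisms `P ⟶ X`. -/
lemma IsDenseGenerator.exists_isUniversalAction {C : Type u} [Category.{v} C] [Preadditive C]
    [MonoidalCategory C] [RigidCategory C] [MonoidalPreadditive C] {P : C}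
    (hP : IsDenseGenerator P) (hC : HasJointEqualizers.{v} C) :
    ∃ (E : C) (a : ∀ X : C, E ⊗ X ⟶ X), IsUniversalAction a := by
  obtain ⟨E, κ, _, hκ⟩ := hC (fun s : P ⟶ P => s ▷ Pᘁ) (fun s => P ◁ sᘁ)
  simp only [dinatural_iff_natural] at hκ
  have κ_natural : ∀ s : P ⟶ P, E ◁ s ≫ uncurryDual κ = uncurryDual κ ≫ s :=
    (hκ κ).2 ⟨𝟙 E, Category.id_comp κ⟩
  have hom_ext {Z X V : C} {f g : Z ⊗ X ⟶ V} (h : ∀ p : P ⟶ X, Z ◁ p ≫ f = Z ◁ p ≫ g) :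
      f = g := hP.map_hom_ext (tensorLeftAdjunction (ᘁZ) Z) h
  have exists_act (X : C) :
      ∃ aX : E ⊗ X ⟶ X, ∀ p : P ⟶ X, uncurryDual κ ≫ p = E ◁ p ≫ aX :=
    hP.exists_map_hom (tensorLeftAdjunction (ᘁE) E) _ (fun _ _ => Preadditive.comp_add _ _ _ _ _ _)
      fun s p => by rw [← Category.assoc, ← κ_natural, Category.assoc]; rfl
  choose a ha using exists_act
  have haP : a P = uncurryDual κ := by simpa using (ha P (𝟙 P)).symm
  refine ⟨E, a, ⟨fun {X Y} f => hom_ext fun p => ?_, fun {Z} t ht => ?_, fun {Z f g} h => ?_⟩⟩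
  · rw [← whiskerLeft_comp_assoc, ← ha, ← reassoc_of% ha]
  · obtain ⟨y, hy⟩ := (hκ (uncurryDual.symm (t P))).1 fun s => by
      rw [Equiv.apply_symm_apply, ht]
    refine ⟨y, fun X => hom_ext fun p => ?_⟩
    rw [whisker_exchange_assoc, ← ha, ht, ← reassoc_of% uncurryDual_comp, hy,
      Equiv.apply_symm_apply]
  · rw [← cancel_mono κ]
    refine uncurryDual.injective ?_
    rw [uncurryDual_comp, uncurryDual_comp, ← haP, h]

/-! ### Faithful actions and actions on tensor products -/

section FaithfulAction

open BraidedCategory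

variable {C : Type u} [Category.{v} C] [MonoidalCategory C]

/-- A family of morphisms `M ⊗ X i ⟶ Y i` that jointly detects morphisms into `M`. -/
def IsFaithfulAction {ι : Type*} {M : C} {X Y : ι → C} (a : ∀ i, M ⊗ X i ⟶ Y i) : Prop :=
  ∀ ⦃Z : C⦄ ⦃f g : Z ⟶ M⦄, (∀ i, f ▷ X i ≫ a i = g ▷ X i ≫ a i) → f = g

lemma IsUniversalAction.isFaithfulAction {E : C} {a : ∀ X : C, E ⊗ X ⟶ X}
    (ha : IsUniversalAction a) : IsFaithfulAction a :=
  fun _ _ _ h => ha.hom_ext h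

/-- The morphism `W ⊗ Y ⟶ V ⊗ Y'` obtained from `s : W ⟶ V ⊗ N` by letting the factor `N` act. -/
def applyRight {W V N Y Y' : C} (s : W ⟶ V ⊗ N) (b : N ⊗ Y ⟶ Y') : W ⊗ Y ⟶ V ⊗ Y' :=
  s ▷ Y ≫ (α_ _ _ _).hom ≫ V ◁ b

lemma comp_applyRight {W' W V N Y Y' : C} (g : W' ⟶ W) (s : W ⟶ V ⊗ N) (b : N ⊗ Y ⟶ Y') :
    applyRight (g ≫ s) b = g ▷ Y ≫ applyRight s b := by
  simp only [applyRight, comp_whiskerRight, Category.assoc]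

lemma applyRight_comp_whiskerRight {W V V' N Y Y' : C} (s : W ⟶ V ⊗ N) (f : V ⟶ V')
    (b : N ⊗ Y ⟶ Y') : applyRight (s ≫ f ▷ N) b = applyRight s b ≫ f ▷ Y' := by
  simp only [applyRight, comp_whiskerRight, Category.assoc, associator_naturality_left_assoc]
  rw [← whisker_exchange]

lemma tensorLeftHomEquiv_symm_applyRight {W V V' N Y Y' : C} [ExactPairing V V'] (s : W ⟶ V ⊗ N)
    (b : N ⊗ Y ⟶ Y') :
    (α_ _ _ _).hom ≫ (tensorLeftHomEquiv (W ⊗ Y) V V' Y').symm (applyRight s b) =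
      (tensorLeftHomEquiv W V V' N).symm s ▷ Y ≫ b := by
  simp only [tensorLeftHomEquiv, Equiv.coe_fn_symm_mk, applyRight]
  calc
    _ = (V' ◁ s) ▷ Y ⊗≫ (ε_ V V' ▷ (N ⊗ Y) ≫ 𝟙_ C ◁ b) ⊗≫ 𝟙 _ := by
      rw [← whisker_exchange]; monoidal
    _ = _ := by monoidal

lemma IsFaithfulAction.applyRight_ext {κ : Type*} {N : C} {Y Y' : κ → C}
    {b : ∀ j, N ⊗ Y j ⟶ Y' j} (hb : IsFaithfulAction b) {W V : C} [HasRightDual V]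
    {s t : W ⟶ V ⊗ N} (hst : ∀ j, applyRight s (b j) = applyRight t (b j)) : s = t :=
  (tensorLeftHomEquiv W V Vᘁ N).symm.injective <| hb fun j => by
    rw [← tensorLeftHomEquiv_symm_applyRight, ← tensorLeftHomEquiv_symm_applyRight, hst]

lemma IsUniversalAction.exists_applyRight_eq {E : C} {a : ∀ X : C, E ⊗ X ⟶ X}
    (ha : IsUniversalAction a) {V W : C} [HasRightDual V] (t : ∀ Y : C, W ⊗ Y ⟶ V ⊗ Y)
    (ht : ∀ {X Y : C} (f : X ⟶ Y), W ◁ f ≫ t Y = t X ≫ V ◁ f) :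
    ∃ s : W ⟶ V ⊗ E, ∀ Y, applyRight s (a Y) = t Y := by
  obtain ⟨g, hg⟩ := ha.exists_lift
    (fun Y => (α_ Vᘁ W Y).hom ≫ (tensorLeftHomEquiv (W ⊗ Y) V Vᘁ Y).symm (t Y))
    fun {X Y} f => by
      rw [associator_naturality_right_assoc, ← tensorLeftHomEquiv_symm_naturality, ht,
        Category.assoc]
      congr 1
      rw [Equiv.symm_apply_eq, tensorLeftHomEquiv_naturality, Equiv.apply_symm_apply]
  refine ⟨tensorLeftHomEquiv W V Vᘁ E g, fun Y =>
    (tensorLeftHomEquiv (W ⊗ Y) V Vᘁ Y).symm.injective ?_⟩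
  rw [← cancel_epi (α_ _ _ _).hom, tensorLeftHomEquiv_symm_applyRight, Equiv.symm_apply_apply, hg]

variable [BraidedCategory C]

/-- The morphism `W ⊗ X ⟶ X' ⊗ V` obtained from `s : W ⟶ M ⊗ V` by letting the factor `M` act,
after braiding `V` past `X`. -/
def applyLeft {W M V X X' : C} (s : W ⟶ M ⊗ V) (a : M ⊗ X ⟶ X') : W ⊗ X ⟶ X' ⊗ V :=
  s ▷ X ≫ (α_ _ _ _).hom ≫ M ◁ (β_ V X).hom ≫ (α_ _ _ _).inv ≫ a ▷ V

lemma applyRight_applyLeft {W M N X X' Y Y' : C} (s : W ⟶ M ⊗ N) (a : M ⊗ X ⟶ X')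
    (b : N ⊗ Y ⟶ Y') : applyRight (applyLeft s a) b =
      (α_ _ _ _).hom ≫ s ▷ (X ⊗ Y) ≫ tensorμ M N X Y ≫ (a ⊗ₘ b) := by
  rw [applyRight, applyLeft, MonoidalCategory.tensorHom_def, tensorμ]
  monoidal

lemma evaluation_whiskerRight_braiding (V' V X : C) [ExactPairing V' V] :
    ε_ V' V ▷ X ≫ (λ_ _).hom ≫ (ρ_ _).inv = (α_ _ _ _).hom ≫ V ◁ (β_ V' X).hom ≫
      (α_ _ _ _).inv ≫ (β_ V X).hom ▷ V' ≫ (α_ _ _ _).hom ≫ X ◁ ε_ V' V := by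
  have h := braiding_naturality_left (ε_ V' V) X
  rw [braiding_tensor_left_hom, braiding_tensorUnit_left] at h
  rw [h]; simp only [Category.assoc]

lemma tensorRightHomEquiv_symm_applyLeft {W M V V' X X' : C} [ExactPairing V' V] (s : W ⟶ M ⊗ V)
    (a : M ⊗ X ⟶ X') :
    (α_ _ _ _).hom ≫ W ◁ (β_ V' X).hom ≫ (α_ _ _ _).inv ≫
        (tensorRightHomEquiv (W ⊗ X) V' V X').symm (applyLeft s a) =
      (tensorRightHomEquiv W V' V M).symm s ▷ X ≫ a := by
  simp only [tensorRightHomEquiv, Equiv.coe_fn_symm_mk, applyLeft]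
  calc
    _ = 𝟙 _ ⊗≫ (s ▷ (V' ⊗ X) ≫ (M ⊗ V) ◁ (β_ V' X).hom) ⊗≫
          M ◁ (β_ V X).hom ▷ V' ⊗≫ ((M ⊗ X) ◁ ε_ V' V ≫ a ▷ 𝟙_ C) ⊗≫ 𝟙 _ := by
      rw [← whisker_exchange s, whisker_exchange a]; monoidal
    _ = 𝟙 _ ⊗≫ s ▷ V' ▷ X ⊗≫ M ◁ (ε_ V' V ▷ X ≫ (λ_ _).hom ≫ (ρ_ _).inv) ⊗≫ a := by
      rw [evaluation_whiskerRight_braiding]; monoidal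
    _ = _ := by monoidal

lemma IsFaithfulAction.applyLeft_ext {ι : Type*} {M : C} {X X' : ι → C} {a : ∀ i, M ⊗ X i ⟶ X' i}
    (ha : IsFaithfulAction a) {W V : C} [HasLeftDual V] {s t : W ⟶ M ⊗ V}
    (hst : ∀ i, applyLeft s (a i) = applyLeft t (a i)) : s = t :=
  (tensorRightHomEquiv W (ᘁV) V M).symm.injective <| ha fun i => by
    rw [← tensorRightHomEquiv_symm_applyLeft, ← tensorRightHomEquiv_symm_applyLeft, hst]

lemma IsUniversalAction.exists_applyLeft_eq {E : C} {a : ∀ X : C, E ⊗ X ⟶ X}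
    (ha : IsUniversalAction a) {V W : C} [HasLeftDual V] (t : ∀ X : C, W ⊗ X ⟶ X ⊗ V)
    (ht : ∀ {X Y : C} (f : X ⟶ Y), W ◁ f ≫ t Y = t X ≫ f ▷ V) :
    ∃ s : W ⟶ E ⊗ V, ∀ X, applyLeft s (a X) = t X := by
  obtain ⟨g, hg⟩ := ha.exists_lift
    (fun X => (α_ W (ᘁV) X).hom ≫ W ◁ (β_ (ᘁV) X).hom ≫ (α_ _ _ _).inv ≫
      (tensorRightHomEquiv (W ⊗ X) (ᘁV) V X).symm (t X))
    fun {X Y} f => by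
      rw [associator_naturality_right_assoc, ← whiskerLeft_comp_assoc, braiding_naturality_right,
        whiskerLeft_comp_assoc, associator_inv_naturality_middle_assoc,
        ← tensorRightHomEquiv_symm_naturality, ht]
      simp only [Category.assoc]
      congr 3
      rw [Equiv.symm_apply_eq, tensorRightHomEquiv_naturality, Equiv.apply_symm_apply]
  refine ⟨tensorRightHomEquiv W (ᘁV) V E g, fun X =>
    (tensorRightHomEquiv (W ⊗ X) (ᘁV) V X).symm.injective ?_⟩
  rw [← cancel_epi (α_ _ _ _).inv, ← cancel_epi (W ◁ (β_ (ᘁV) X).hom),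
    ← cancel_epi (α_ _ _ _).hom, tensorRightHomEquiv_symm_applyLeft, Equiv.symm_apply_apply, hg]

lemma IsFaithfulAction.tensor [RigidCategory C] {ι κ : Type*} {M N : C} {X X' : ι → C}
    {Y Y' : κ → C} {a : ∀ i, M ⊗ X i ⟶ X' i} {b : ∀ j, N ⊗ Y j ⟶ Y' j}
    (ha : IsFaithfulAction a) (hb : IsFaithfulAction b) :
    IsFaithfulAction (ι := ι × κ) (X := fun p => X p.1 ⊗ Y p.2) (Y := fun p => X' p.1 ⊗ Y' p.2)
      (fun p => tensorμ M N (X p.1) (Y p.2) ≫ (a p.1 ⊗ₘ b p.2)) := fun Z f g h =>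
  ha.applyLeft_ext fun i => hb.applyRight_ext fun j => by
    rw [applyRight_applyLeft, applyRight_applyLeft, h (i, j)]

end FaithfulAction

section TensorAction

open BraidedCategory

variable {C : Type u} [Category.{v} C] [MonoidalCategory C] {E : C} (a : ∀ X : C, E ⊗ X ⟶ X)

/-- The action of `E` on the first factor of `X ⊗ Y`. -/
def actFst (X Y : C) : E ⊗ (X ⊗ Y) ⟶ X ⊗ Y := (α_ _ _ _).inv ≫ a X ▷ Y

lemma actFst_naturality_right (X : C) {Y Y' : C} (g : Y ⟶ Y') :
    E ◁ X ◁ g ≫ actFst a X Y' = actFst a X Y ≫ X ◁ g := by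
  rw [actFst, actFst, associator_inv_naturality_right_assoc, whisker_exchange, Category.assoc]

variable [BraidedCategory C]

/-- The action of `E` on the second factor of `X ⊗ Y`. -/
def actSnd (X Y : C) : E ⊗ (X ⊗ Y) ⟶ X ⊗ Y :=
  E ◁ (β_ Y X).inv ≫ actFst a Y X ≫ (β_ Y X).hom

/-- The action of `E ⊗ E` on `X ⊗ Y`. -/
def actTensor (X Y : C) : (E ⊗ E) ⊗ (X ⊗ Y) ⟶ X ⊗ Y :=
  (α_ _ _ _).hom ≫ E ◁ actSnd a X Y ≫ actFst a X Y

lemma actSnd_eq (X Y : C) :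
    actSnd a X Y = (α_ _ _ _).inv ≫ (β_ E X).hom ▷ Y ≫ (α_ _ _ _).hom ≫ X ◁ a Y := by
  simp only [actSnd, actFst, Category.assoc]
  rw [braiding_naturality_left (a Y) X, braiding_tensor_left_hom]
  simp

lemma actSnd_naturality_left {X X' : C} (f : X ⟶ X')
    (Y : C) : E ◁ f ▷ Y ≫ actSnd a X' Y = actSnd a X Y ≫ f ▷ Y := by
  simp only [actSnd, Category.assoc]
  rw [← whiskerLeft_comp_assoc, braiding_inv_naturality_left, whiskerLeft_comp_assoc,
    reassoc_of% actFst_naturality_right, braiding_naturality_right]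

lemma actTensor_eq (X Y : C) :
    actTensor a X Y = tensorμ E E X Y ≫ (a X ⊗ₘ a Y) := by
  rw [actTensor, actSnd_eq, actFst, MonoidalCategory.tensorHom_def, tensorμ]
  calc
    _ = 𝟙 _ ⊗≫ E ◁ (β_ E X).hom ▷ Y ⊗≫ ((E ⊗ X) ◁ a Y ≫ a X ▷ Y) := by monoidal
    _ = _ := by rw [whisker_exchange]; monoidal

lemma tensorHom_whiskerRight_actTensor {M N : C} (f : M ⟶ E) (g : N ⟶ E) (X Y : C) :
    (f ⊗ₘ g) ▷ (X ⊗ Y) ≫ actTensor a X Y =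
      tensorμ M N X Y ≫ ((f ▷ X ≫ a X) ⊗ₘ (g ▷ Y ≫ a Y)) := by
  rw [actTensor_eq, tensorμ_natural_left_assoc, tensorHom_comp_tensorHom]

lemma braiding_actTensor (X Y : C) :
    (β_ E E).hom ▷ (X ⊗ Y) ≫ actTensor a X Y =
      (α_ _ _ _).hom ≫ E ◁ actFst a X Y ≫ actSnd a X Y := by
  rw [actTensor, actSnd_eq, actFst]
  calc
    _ = 𝟙 _ ⊗≫ (β_ E E).hom ▷ X ▷ Y ⊗≫ E ◁ (β_ E X).hom ▷ Y ⊗≫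
          ((E ⊗ X) ◁ a Y ≫ a X ▷ Y) := by monoidal
    _ = 𝟙 _ ⊗≫ ((α_ E E X).inv ≫ (β_ E E).hom ▷ X ≫ (α_ E E X).hom ≫ E ◁ (β_ E X).hom ≫
          (α_ E X E).inv) ▷ Y ⊗≫ (a X ▷ (E ⊗ Y) ≫ X ◁ a Y) ⊗≫ 𝟙 _ := by
      rw [whisker_exchange]; monoidal
    _ = 𝟙 _ ⊗≫ ((β_ E (E ⊗ X)).hom ≫ a X ▷ E) ▷ Y ⊗≫ X ◁ a Y := by
      rw [braiding_tensor_right_hom]; monoidal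
    _ = _ := by rw [← braiding_naturality_right]; monoidal

namespace IsUniversalAction

variable {a} [RigidCategory C]

lemma hom_ext₂ (ha : IsUniversalAction a) {Z : C} {f g : Z ⟶ E ⊗ E}
    (h : ∀ X Y, f ▷ (X ⊗ Y) ≫ actTensor a X Y = g ▷ (X ⊗ Y) ≫ actTensor a X Y) : f = g :=
  ha.isFaithfulAction.tensor ha.isFaithfulAction fun p => by
    simpa only [actTensor_eq] using h p.1 p.2

lemma hom_ext₃ (ha : IsUniversalAction a) {Z : C} {f g : Z ⟶ (E ⊗ E) ⊗ E}
    (h : ∀ X Y T, f ▷ ((X ⊗ Y) ⊗ T) ≫ tensorμ _ _ _ _ ≫ (actTensor a X Y ⊗ₘ a T) =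
      g ▷ ((X ⊗ Y) ⊗ T) ≫ tensorμ _ _ _ _ ≫ (actTensor a X Y ⊗ₘ a T)) : f = g :=
  (ha.isFaithfulAction.tensor ha.isFaithfulAction).tensor ha.isFaithfulAction fun p => by
    simpa only [actTensor_eq] using h p.1.1 p.1.2 p.2

lemma exists_lift₂ (ha : IsUniversalAction a) {Z : C} (t : ∀ X Y : C, Z ⊗ (X ⊗ Y) ⟶ X ⊗ Y)
    (ht : ∀ {X Y X' Y' : C} (f : X ⟶ X') (g : Y ⟶ Y'),
      Z ◁ (f ⊗ₘ g) ≫ t X' Y' = t X Y ≫ (f ⊗ₘ g)) :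
    ∃ f : Z ⟶ E ⊗ E, ∀ X Y, f ▷ (X ⊗ Y) ≫ actTensor a X Y = t X Y := by
  have ht₁ {X X' : C} (f : X ⟶ X') (Y : C) : Z ◁ f ▷ Y ≫ t X' Y = t X Y ≫ f ▷ Y := by
    simpa using ht f (𝟙 Y)
  have ht₂ (X : C) {Y Y' : C} (g : Y ⟶ Y') : Z ◁ X ◁ g ≫ t X Y' = t X Y ≫ X ◁ g := by
    simpa using ht (𝟙 X) g
  choose u hu using fun X : C => ha.exists_applyRight_eq (fun Y => (α_ Z X Y).hom ≫ t X Y)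
    fun g => by rw [associator_naturality_right_assoc, ht₂, Category.assoc]
  obtain ⟨f, hf⟩ := ha.exists_applyLeft_eq u fun {X X'} f =>
    ha.isFaithfulAction.applyRight_ext fun Y => by
      rw [comp_applyRight, applyRight_comp_whiskerRight, hu, hu,
        associator_naturality_middle_assoc, ht₁, Category.assoc]
  refine ⟨f, fun X Y => ?_⟩
  rw [actTensor_eq, ← cancel_epi (α_ _ _ _).hom, ← applyRight_applyLeft, hf, hu]

end IsUniversalAction

end TensorAction

/-! ### Bialgebra and ribbon structures described by their action -/

section BialgebraAction

open BraidedCategory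

variable {C : Type u} [Category.{v} C] [MonoidalCategory C] [BraidedCategory C] {E : C}

lemma tensorμ_actTensor_tensorHom (a : ∀ X : C, E ⊗ X ⟶ X) (X Y T : C) :
    tensorμ (E ⊗ E) E (X ⊗ Y) T ≫ (actTensor a X Y ⊗ₘ a T) =
      ((α_ E E E).hom ⊗ₘ (α_ X Y T).hom) ≫ tensorμ E (E ⊗ E) X (Y ⊗ T) ≫
        (a X ⊗ₘ actTensor a Y T) ≫ (α_ X Y T).inv := by
  have h := associator_monoidal E E E X Y T =≫ ((a X ⊗ₘ a Y ⊗ₘ a T) ≫ (α_ X Y T).inv)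
  simp only [Category.assoc] at h
  rw [actTensor_eq, actTensor_eq]
  calc
    _ = tensorμ (E ⊗ E) E (X ⊗ Y) T ≫ tensorμ E E X Y ▷ (E ⊗ T) ≫
        (α_ (E ⊗ X) (E ⊗ Y) (E ⊗ T)).hom ≫ (a X ⊗ₘ a Y ⊗ₘ a T) ≫ (α_ X Y T).inv := by
      rw [← associator_naturality_assoc, Iso.hom_inv_id, Category.comp_id, ← tensorHom_id,
        tensorHom_comp_tensorHom, Category.id_comp]
    _ = _ := by
      rw [h, ← id_tensorHom, tensorHom_comp_tensorHom_assoc, Category.id_comp]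

/-- The product, unit, coproduct and counit of `E` are determined by the action of `E`: products
act by composition, the coproduct by the action on tensor products. -/
structure IsBialgebraAction (a : ∀ X : C, E ⊗ X ⟶ X) (D : BPRibbonData E) : Prop where
  mul : ∀ X, D.mul ▷ X ≫ a X = (α_ _ _ _).hom ≫ E ◁ a X ≫ a X
  one : ∀ X, D.one ▷ X ≫ a X = (λ_ X).hom
  comul : ∀ X Y, D.comul ▷ (X ⊗ Y) ≫ actTensor a X Y = a (X ⊗ Y)
  counit : a (𝟙_ C) = (ρ_ E).hom ≫ D.counit

namespace IsBialgebraAction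

variable {a : ∀ X : C, E ⊗ X ⟶ X} {D : BPRibbonData E}

lemma mul_actFst (hD : IsBialgebraAction a D) (X Y : C) :
    D.mul ▷ (X ⊗ Y) ≫ actFst a X Y = (α_ _ _ _).hom ≫ E ◁ actFst a X Y ≫ actFst a X Y := by
  calc
    _ = 𝟙 _ ⊗≫ (D.mul ▷ X ≫ a X) ▷ Y := by rw [actFst]; monoidal
    _ = _ := by rw [hD.mul, actFst]; monoidal

lemma mul_actSnd (hD : IsBialgebraAction a D) (X Y : C) :
    D.mul ▷ (X ⊗ Y) ≫ actSnd a X Y = (α_ _ _ _).hom ≫ E ◁ actSnd a X Y ≫ actSnd a X Y := by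
  rw [actSnd, ← whisker_exchange_assoc, reassoc_of% hD.mul_actFst]
  simp

lemma tensorHom_mul_actTensor (hD : IsBialgebraAction a D) (X Y : C) :
    (D.mul ⊗ₘ D.mul) ▷ (X ⊗ Y) ≫ actTensor a X Y =
      𝟙 _ ⊗≫ (E ⊗ E) ◁ (E ◁ actSnd a X Y ≫ actSnd a X Y) ⊗≫ E ◁ actFst a X Y ≫ actFst a X Y := by
  rw [MonoidalCategory.tensorHom_def', actTensor]
  calc
    _ = 𝟙 _ ⊗≫ (E ⊗ E) ◁ D.mul ▷ (X ⊗ Y) ⊗≫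
        (D.mul ▷ (E ⊗ (X ⊗ Y)) ≫ E ◁ actSnd a X Y) ≫ actFst a X Y := by monoidal
    _ = 𝟙 _ ⊗≫ (E ⊗ E) ◁ (D.mul ▷ (X ⊗ Y) ≫ actSnd a X Y) ⊗≫
        (D.mul ▷ (X ⊗ Y) ≫ actFst a X Y) := by
      rw [← whisker_exchange]; monoidal
    _ = _ := by rw [hD.mul_actFst, hD.mul_actSnd]; monoidal

lemma mulTensor_actTensor (hD : IsBialgebraAction a D) (X Y : C) :
    D.mulTensor ▷ (X ⊗ Y) ≫ actTensor a X Y =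
      (α_ _ _ _).hom ≫ (E ⊗ E) ◁ actTensor a X Y ≫ actTensor a X Y := by
  rw [BPRibbonData.mulTensor, comp_whiskerRight_assoc, tensorHom_whiskerRight_actTensor, hD.mul,
    hD.mul, ← tensorHom_comp_tensorHom, tensor_associativity_assoc, ← tensorHom_comp_tensorHom,
    ← tensorμ_natural_right_assoc, actTensor_eq]
  simp

lemma mulTensor_left_actTensor (hD : IsBialgebraAction a D) {w : 𝟙_ C ⟶ E ⊗ E} {X Y : C}
    {φ : X ⊗ Y ⟶ X ⊗ Y} (hw : w ▷ (X ⊗ Y) ≫ actTensor a X Y = (λ_ _).hom ≫ φ) :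
    ((λ_ (E ⊗ E)).inv ≫ w ▷ (E ⊗ E) ≫ D.mulTensor) ▷ (X ⊗ Y) ≫ actTensor a X Y =
      actTensor a X Y ≫ φ := by
  simp only [comp_whiskerRight, Category.assoc, hD.mulTensor_actTensor]
  rw [associator_naturality_left_assoc, ← whisker_exchange_assoc, hw]
  simp

lemma mulTensor_right_actTensor (hD : IsBialgebraAction a D) {w : 𝟙_ C ⟶ E ⊗ E} {X Y : C}
    {φ : X ⊗ Y ⟶ X ⊗ Y} (hw : w ▷ (X ⊗ Y) ≫ actTensor a X Y = (λ_ _).hom ≫ φ) :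
    ((ρ_ (E ⊗ E)).inv ≫ (E ⊗ E) ◁ w ≫ D.mulTensor) ▷ (X ⊗ Y) ≫ actTensor a X Y =
      (E ⊗ E) ◁ φ ≫ actTensor a X Y := by
  simp only [comp_whiskerRight, Category.assoc, hD.mulTensor_actTensor]
  rw [associator_naturality_middle_assoc, ← whiskerLeft_comp_assoc _ (w ▷ _), hw,
    whiskerLeft_comp_assoc, triangle_assoc, ← comp_whiskerRight_assoc]
  simp

lemma leftMul_act (hD : IsBialgebraAction a D) {p : 𝟙_ C ⟶ E} {X : C} {φ : X ⟶ X}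
    (h : p ▷ X ≫ a X = (λ_ X).hom ≫ φ) : D.leftMul p ▷ X ≫ a X = a X ≫ φ := by
  simp only [BPRibbonData.leftMul, comp_whiskerRight, Category.assoc, hD.mul]
  rw [associator_naturality_left_assoc, ← whisker_exchange_assoc, h]
  simp

lemma rightMul_act (hD : IsBialgebraAction a D) {p : 𝟙_ C ⟶ E} {X : C} {φ : X ⟶ X}
    (h : p ▷ X ≫ a X = (λ_ X).hom ≫ φ) : D.rightMul p ▷ X ≫ a X = E ◁ φ ≫ a X := by
  simp only [BPRibbonData.rightMul, comp_whiskerRight, Category.assoc, hD.mul]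
  rw [associator_naturality_middle_assoc, ← whiskerLeft_comp_assoc E (p ▷ X), h]
  simp

lemma leftMul_tensor_rightMul_act (ha : IsUniversalAction a) (hD : IsBialgebraAction a D)
    {p q : 𝟙_ C ⟶ E} {X Y : C} {φ : X ⟶ X} {ψ : Y ⟶ Y} (hp : p ▷ X ≫ a X = (λ_ X).hom ≫ φ)
    (hq : q ▷ Y ≫ a Y = (λ_ Y).hom ≫ ψ) :
    (D.leftMul p ⊗ₘ D.rightMul q) ▷ (X ⊗ Y) ≫ actTensor a X Y = actTensor a X Y ≫ (φ ⊗ₘ ψ) := by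
  rw [tensorHom_whiskerRight_actTensor, hD.leftMul_act hp, hD.rightMul_act hq, ha.naturality,
    ← tensorHom_comp_tensorHom, actTensor_eq, Category.assoc]

lemma one_mul (ha : IsUniversalAction a) (hD : IsBialgebraAction a D) :
    D.one ▷ E ≫ D.mul = (λ_ E).hom := ha.hom_ext fun X => by
  simp only [comp_whiskerRight, Category.assoc, hD.mul]
  rw [associator_naturality_left_assoc, ← whisker_exchange_assoc, hD.one]
  simp

lemma mul_one (ha : IsUniversalAction a) (hD : IsBialgebraAction a D) :
    E ◁ D.one ≫ D.mul = (ρ_ E).hom := ha.hom_ext fun X => by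
  simp only [comp_whiskerRight, Category.assoc, hD.mul]
  rw [associator_naturality_middle_assoc, ← whiskerLeft_comp_assoc, hD.one]
  simp

lemma mul_assoc (ha : IsUniversalAction a) (hD : IsBialgebraAction a D) :
    D.mul ▷ E ≫ D.mul = (α_ E E E).hom ≫ E ◁ D.mul ≫ D.mul :=
  ha.hom_ext fun X => by
    simp only [comp_whiskerRight, Category.assoc, hD.mul]
    rw [associator_naturality_left_assoc, ← whisker_exchange_assoc, hD.mul,
      associator_naturality_middle_assoc, ← whiskerLeft_comp_assoc, hD.mul]
    simp

lemma counit_whiskerRight_act (hD : IsBialgebraAction a D) (X : C) :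
    D.counit ▷ E ▷ X ≫ (λ_ E).hom ▷ X ≫ a X =
    (E ⊗ E) ◁ (λ_ X).inv ≫ actTensor a (𝟙_ C) X ≫ (λ_ X).hom := by
  rw [actTensor_eq, hD.counit, tensorμ, braiding_tensorUnit_right,
    MonoidalCategory.tensorHom_def]
  calc
    _ = 𝟙 _ ⊗≫ (D.counit ▷ (E ⊗ X) ≫ 𝟙_ C ◁ a X) ⊗≫ 𝟙 _ := by monoidal
    _ = _ := by monoidal

lemma counit_comul (ha : IsUniversalAction a) (hD : IsBialgebraAction a D) :
    D.comul ≫ D.counit ▷ E = (λ_ E).inv := by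
  rw [← cancel_mono (λ_ E).hom, Iso.inv_hom_id]
  refine ha.hom_ext fun X => ?_
  simp only [comp_whiskerRight, Category.assoc]
  rw [hD.counit_whiskerRight_act, ← whisker_exchange_assoc, reassoc_of% hD.comul,
    ← Category.assoc, ha.naturality]
  simp

lemma whiskerLeft_counit_act (hD : IsBialgebraAction a D) (X : C) :
    (E ◁ D.counit) ▷ X ≫ (ρ_ E).hom ▷ X ≫ a X =
    (E ⊗ E) ◁ (ρ_ X).inv ≫ actTensor a X (𝟙_ C) ≫ (ρ_ X).hom := by
  rw [actTensor_eq, hD.counit, tensorμ, MonoidalCategory.tensorHom_def']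
  calc
    _ = 𝟙 _ ⊗≫ E ◁ (D.counit ▷ X ≫ (λ_ X).hom ≫ (ρ_ X).inv) ⊗≫ a X ⊗≫ 𝟙 _ := by monoidal
    _ = 𝟙 _ ⊗≫ E ◁ (D.counit ▷ X ≫ (β_ (𝟙_ C) X).hom) ⊗≫ a X ⊗≫ 𝟙 _ := by
      rw [braiding_tensorUnit_left]
    _ = _ := by rw [braiding_naturality_left]; monoidal

lemma comul_counit (ha : IsUniversalAction a) (hD : IsBialgebraAction a D) :
    D.comul ≫ E ◁ D.counit = (ρ_ E).inv := by
  rw [← cancel_mono (ρ_ E).hom, Iso.inv_hom_id]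
  refine ha.hom_ext fun X => ?_
  simp only [comp_whiskerRight, Category.assoc]
  rw [hD.whiskerLeft_counit_act, ← whisker_exchange_assoc, reassoc_of% hD.comul,
    ← Category.assoc, ha.naturality]
  simp

lemma comul_act_left (hD : IsBialgebraAction a D) (X Y T : C) :
    (D.comul ▷ E) ▷ ((X ⊗ Y) ⊗ T) ≫ tensorμ _ _ _ _ ≫ (actTensor a X Y ⊗ₘ a T) =
      actTensor a (X ⊗ Y) T := by
  rw [← tensorHom_id D.comul, tensorμ_natural_left_assoc, tensorHom_comp_tensorHom, hD.comul,
    actTensor_eq]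
  simp

lemma comul_act_right (hD : IsBialgebraAction a D) (X Y T : C) :
    (E ◁ D.comul ≫ (α_ E E E).inv) ▷ ((X ⊗ Y) ⊗ T) ≫ tensorμ _ _ _ _ ≫
      (actTensor a X Y ⊗ₘ a T) =
      (E ⊗ E) ◁ (α_ X Y T).hom ≫ actTensor a X (Y ⊗ T) ≫ (α_ X Y T).inv := by
  rw [tensorμ_actTensor_tensorHom, ← tensorHom_id, tensorHom_comp_tensorHom_assoc,
    Category.assoc, Iso.inv_hom_id, Category.comp_id, Category.id_comp,
    MonoidalCategory.tensorHom_def', Category.assoc, ← id_tensorHom E, tensorμ_natural_left_assoc,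
    tensorHom_comp_tensorHom_assoc, hD.comul, actTensor_eq]
  simp

lemma mul_counit (hD : IsBialgebraAction a D) :
    D.mul ≫ D.counit = (D.counit ⊗ₘ D.counit) ≫ (λ_ _).hom := by
  have h := hD.mul (𝟙_ C)
  rw [hD.counit] at h
  rw [← cancel_epi (ρ_ (E ⊗ E)).hom]
  calc
    _ = D.mul ▷ 𝟙_ C ≫ (ρ_ E).hom ≫ D.counit := by simp
    _ = _ := by rw [h, MonoidalCategory.tensorHom_def']; monoidal

lemma one_counit (hD : IsBialgebraAction a D) : D.one ≫ D.counit = 𝟙 (𝟙_ C) := by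
  have h := hD.one (𝟙_ C)
  rw [hD.counit] at h
  rw [← cancel_epi (ρ_ (𝟙_ C)).hom]
  simpa [unitors_equal] using h

variable [RigidCategory C]

lemma comul_coassoc (ha : IsUniversalAction a) (hD : IsBialgebraAction a D) :
    D.comul ≫ E ◁ D.comul = D.comul ≫ D.comul ▷ E ≫ (α_ E E E).hom := by
  rw [← cancel_mono (α_ E E E).inv]
  refine ha.hom_ext₃ fun X Y T => ?_
  simp only [Category.assoc, Iso.hom_inv_id, Category.comp_id]
  rw [comp_whiskerRight_assoc, hD.comul_act_right, comp_whiskerRight_assoc, hD.comul_act_left,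
    hD.comul, ← whisker_exchange_assoc, reassoc_of% hD.comul, ← Category.assoc, ha.naturality]
  simp

lemma mul_comul (ha : IsUniversalAction a) (hD : IsBialgebraAction a D) :
    D.mul ≫ D.comul = (D.comul ⊗ₘ D.comul) ≫ D.mulTensor :=
  ha.hom_ext₂ fun X Y => by
    rw [comp_whiskerRight_assoc, hD.comul, hD.mul, comp_whiskerRight_assoc,
      hD.mulTensor_actTensor, MonoidalCategory.tensorHom_def']
    simp only [comp_whiskerRight, Category.assoc]
    rw [associator_naturality_left_assoc, ← whisker_exchange_assoc, hD.comul,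
      associator_naturality_middle_assoc, ← whiskerLeft_comp_assoc, hD.comul]

lemma one_comul (ha : IsUniversalAction a) (hD : IsBialgebraAction a D) :
    D.one ≫ D.comul = (λ_ _).inv ≫ (D.one ⊗ₘ D.one) :=
  ha.hom_ext₂ fun X Y => by
    rw [comp_whiskerRight_assoc, hD.comul, hD.one, comp_whiskerRight_assoc,
      tensorHom_whiskerRight_actTensor, hD.one, hD.one, tensor_left_unitality]

end IsBialgebraAction

end BialgebraAction

section RibbonAction

open BraidedCategory RibbonCategory

variable {C : Type u} [Category.{v} C] [MonoidalCategory C] [BraidedCategory C] [RigidCategory C]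
  [RibbonCategory C] {E : C}

lemma RibbonCategory.twist_tensor_inv (X Y : C) :
    (twist (X ⊗ Y)).inv =
      (β_ Y X).inv ≫ (β_ X Y).inv ≫ ((twist X).inv ⊗ₘ (twist Y).inv) := by
  have h : twist (X ⊗ Y) = β_ X Y ≪≫ β_ Y X ≪≫ (twist X ⊗ᵢ twist Y) :=
    Iso.ext (twist_tensor X Y)
  rw [h, Iso.trans_inv, Iso.trans_inv, tensorIso_inv, Category.assoc,
    braiding_inv_naturality_assoc, braiding_inv_naturality]

/-- A bialgebra action in which the ribbon elements `v₊`, `v₋` act by the inverse twist and the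
twist, and the copairing `w₊` by the inverse double braiding. -/
structure IsRibbonAction (a : ∀ X : C, E ⊗ X ⟶ X) (D : BPRibbonData E) : Prop
    extends IsBialgebraAction a D where
  ribbon : ∀ X, D.ribbon ▷ X ≫ a X = (λ_ X).hom ≫ (twist X).inv
  ribbonInv : ∀ X, D.ribbonInv ▷ X ≫ a X = (λ_ X).hom ≫ (twist X).hom
  copairing : ∀ X Y, D.copairing ▷ (X ⊗ Y) ≫ actTensor a X Y =
    (λ_ _).hom ≫ (β_ Y X).inv ≫ (β_ X Y).inv

namespace IsRibbonAction

variable {a : ∀ X : C, E ⊗ X ⟶ X} {D : BPRibbonData E}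

lemma ribbon_central (ha : IsUniversalAction a) (hD : IsRibbonAction a D) :
    D.leftMul D.ribbon = D.rightMul D.ribbon := ha.hom_ext fun X => by
  rw [hD.leftMul_act (hD.ribbon X), hD.rightMul_act (hD.ribbon X), ha.naturality]

lemma ribbon_ribbonInv (ha : IsUniversalAction a) (hD : IsRibbonAction a D) :
    D.ribbonInv ≫ D.leftMul D.ribbon = D.one := ha.hom_ext fun X => by
  rw [comp_whiskerRight_assoc, hD.leftMul_act (hD.ribbon X), reassoc_of% hD.ribbonInv, hD.one]
  simp

lemma ribbonInv_ribbon (ha : IsUniversalAction a) (hD : IsRibbonAction a D) :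
    D.ribbon ≫ D.leftMul D.ribbonInv = D.one := ha.hom_ext fun X => by
  rw [comp_whiskerRight_assoc, hD.leftMul_act (hD.ribbonInv X), reassoc_of% hD.ribbon, hD.one]
  simp

lemma copairing_eq (ha : IsUniversalAction a) (hD : IsRibbonAction a D) : D.copairing =
    D.ribbon ≫ D.comul ≫ (D.leftMul D.ribbonInv ⊗ₘ D.rightMul D.ribbonInv) :=
  ha.hom_ext₂ fun X Y => by
    simp only [comp_whiskerRight, Category.assoc]
    rw [hD.leftMul_tensor_rightMul_act ha (hD.ribbonInv X) (hD.ribbonInv Y), reassoc_of% hD.comul,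
      reassoc_of% hD.ribbon, hD.copairing, twist_tensor_inv]
    simp

lemma copairing_actSnd_actFst (hD : IsRibbonAction a D) (X Y : C) :
    D.copairing ▷ (X ⊗ Y) ≫ (α_ _ _ _).hom ≫ E ◁ actSnd a X Y ≫ actFst a X Y =
      (λ_ _).hom ≫ (β_ Y X).inv ≫ (β_ X Y).inv :=
  hD.copairing X Y

lemma innerCopairing_actTensor (hD : IsRibbonAction a D) (X Y : C) :
    D.innerCopairing ▷ (X ⊗ Y) ≫ actTensor a X Y =
      (E ⊗ E) ◁ (β_ Y X).inv ≫ (β_ E E).hom ▷ _ ≫ actTensor a Y X ≫ (β_ X Y).inv := by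
  calc
    _ = 𝟙 _ ⊗≫ E ◁ D.copairing ▷ E ▷ (X ⊗ Y) ⊗≫
        ((D.mul ⊗ₘ D.mul) ▷ (X ⊗ Y) ≫ actTensor a X Y) := by
      rw [BPRibbonData.innerCopairing, BPRibbonData.insertCopairing]; monoidal
    _ = 𝟙 _ ⊗≫ E ◁ (D.copairing ▷ (E ⊗ (X ⊗ Y)) ≫ (E ⊗ E) ◁ actSnd a X Y) ⊗≫
        E ◁ E ◁ actSnd a X Y ⊗≫ E ◁ actFst a X Y ≫ actFst a X Y := by
      rw [hD.tensorHom_mul_actTensor]; monoidal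
    _ = 𝟙 _ ⊗≫ E ◁ (𝟙_ C) ◁ actSnd a X Y ⊗≫ E ◁ (D.copairing ▷ (X ⊗ Y) ≫ (α_ _ _ _).hom ≫
          E ◁ actSnd a X Y ≫ actFst a X Y) ≫ actFst a X Y := by
      rw [← whisker_exchange]; monoidal
    _ = 𝟙 _ ⊗≫ E ◁ (actSnd a X Y ≫ (β_ Y X).inv ≫ (β_ X Y).inv) ≫ actFst a X Y := by
      rw [hD.copairing_actSnd_actFst]; monoidal
    _ = 𝟙 _ ⊗≫ E ◁ E ◁ (β_ Y X).inv ⊗≫ E ◁ actFst a Y X ≫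
          (E ◁ (β_ X Y).inv ≫ actFst a X Y ≫ (β_ X Y).hom) ≫ (β_ X Y).inv := by
      rw [actSnd]; simp [monoidalComp]
    _ = 𝟙 _ ⊗≫ E ◁ E ◁ (β_ Y X).inv ⊗≫ ((α_ _ _ _).hom ≫ E ◁ actFst a Y X ≫ actSnd a Y X) ≫
          (β_ X Y).inv := by rw [actSnd]; simp [monoidalComp]
    _ = _ := by rw [← braiding_actTensor]; monoidal

lemma braiding_inv_innerCopairing_actTensor (hD : IsRibbonAction a D) (X Y : C) :
    (β_ E E).inv ▷ (X ⊗ Y) ≫ D.innerCopairing ▷ (X ⊗ Y) ≫ actTensor a X Y =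
      (E ⊗ E) ◁ (β_ Y X).inv ≫ actTensor a Y X ≫ (β_ X Y).inv := by
  rw [hD.innerCopairing_actTensor, ← whisker_exchange_assoc]
  simp

lemma ribbon_comul (ha : IsUniversalAction a) (hD : IsRibbonAction a D) :
    D.leftMul D.ribbon ≫ D.comul =
    D.comul ≫ (β_ E E).inv ≫ D.innerCopairing ≫ (D.leftMul D.ribbon ⊗ₘ D.rightMul D.ribbon) :=
  ha.hom_ext₂ fun X Y => by
    simp only [comp_whiskerRight, Category.assoc]
    rw [hD.comul, hD.leftMul_act (hD.ribbon _),
      hD.leftMul_tensor_rightMul_act ha (hD.ribbon X) (hD.ribbon Y),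
      reassoc_of% hD.braiding_inv_innerCopairing_actTensor, ← whisker_exchange_assoc,
      reassoc_of% hD.comul, ← Category.assoc, ha.naturality, twist_tensor_inv]
    simp

lemma copairing_braiding (ha : IsUniversalAction a) (hD : IsRibbonAction a D) :
    D.innerCopairing ≫ (β_ E E).inv ≫ D.innerCopairing =
    (β_ E E).hom ≫
      ((λ_ (E ⊗ E)).inv ≫ D.copairing ▷ (E ⊗ E) ≫ D.mulTensor) ≫
      ((ρ_ (E ⊗ E)).inv ≫ (E ⊗ E) ◁ D.copairing ≫ D.mulTensor) :=
  ha.hom_ext₂ fun X Y => by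
    rw [comp_whiskerRight_assoc, comp_whiskerRight_assoc,
      hD.braiding_inv_innerCopairing_actTensor, ← whisker_exchange_assoc,
      reassoc_of% hD.innerCopairing_actTensor, comp_whiskerRight_assoc, comp_whiskerRight_assoc,
      hD.mulTensor_right_actTensor (hD.copairing X Y), ← whisker_exchange_assoc,
      hD.mulTensor_left_actTensor (hD.copairing X Y), ← whisker_exchange_assoc]
    simp

end IsRibbonAction

end RibbonAction

/-! ### Duality and the antipode -/

section Duality

open BraidedCategory

variable {C : Type u} [Category.{v} C] [MonoidalCategory C] [RigidCategory C]

lemma leftCoev_leftEv (X : C) : leftCoev X ▷ X ⊗≫ X ◁ leftEv X = ⊗𝟙.hom :=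
  ExactPairing.evaluation_coevaluation'' X Xᘁ

lemma leftEv_leftCoev (X : C) : Xᘁ ◁ leftCoev X ⊗≫ leftEv X ▷ Xᘁ = ⊗𝟙.hom :=
  ExactPairing.coevaluation_evaluation'' X Xᘁ

lemma eq_leftCoev_comp_leftEv {Z X : C} (φ : Z ⊗ X ⟶ X) :
    φ = 𝟙 _ ⊗≫ (Z ◁ leftCoev X ≫ (α_ _ _ _).inv ≫ φ ▷ Xᘁ) ▷ X ⊗≫ X ◁ leftEv X ⊗≫ 𝟙 _ := by
  calc
    _ = 𝟙 _ ⊗≫ Z ◁ (leftCoev X ▷ X ⊗≫ X ◁ leftEv X) ⊗≫ φ ⊗≫ 𝟙 _ := by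
      rw [leftCoev_leftEv]; monoidal
    _ = 𝟙 _ ⊗≫ Z ◁ leftCoev X ▷ X ⊗≫ ((Z ⊗ X) ◁ leftEv X ≫ φ ▷ 𝟙_ C) ⊗≫ 𝟙 _ := by monoidal
    _ = _ := by rw [whisker_exchange]; monoidal

lemma leftEv_cancel {Y X : C} {φ ψ : Y ⟶ X} (h : Xᘁ ◁ φ ≫ leftEv X = Xᘁ ◁ ψ ≫ leftEv X) :
    φ = ψ := by
  have key (φ : Y ⟶ X) : (tensorLeftHomEquiv Y X Xᘁ (𝟙_ C)).symm (φ ≫ (ρ_ X).inv) =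
      Xᘁ ◁ φ ≫ leftEv X := by
    simp [tensorLeftHomEquiv, leftEv, unitors_equal]
  rw [← key, ← key] at h
  simpa using h

lemma leftCoev_cancel {X Y : C} {φ ψ : Xᘁ ⟶ Y}
    (h : leftCoev X ≫ X ◁ φ = leftCoev X ≫ X ◁ ψ) : φ = ψ := by
  have key (φ : Xᘁ ⟶ Y) : tensorLeftHomEquiv (𝟙_ C) X Xᘁ Y ((ρ_ _).hom ≫ φ) =
      leftCoev X ≫ X ◁ φ := by
    simp [tensorLeftHomEquiv, leftCoev, unitors_inv_equal]
  rw [← key, ← key] at h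
  simpa using h

lemma leftCoev_comp_rightAdjointMate {X Y : C} (f : X ⟶ Y) :
    leftCoev Y ≫ Y ◁ fᘁ = leftCoev X ≫ f ▷ Xᘁ :=
  coevaluation_comp_rightAdjointMate f

variable {E : C} {a : ∀ X : C, E ⊗ X ⟶ X}

lemma IsUniversalAction.hom_ext_leftCoev (ha : IsUniversalAction a) {Z : C} {f g : Z ⟶ E}
    (h : ∀ X, Z ◁ leftCoev X ≫ f ▷ (X ⊗ Xᘁ) ≫ actFst a X Xᘁ =
      Z ◁ leftCoev X ≫ g ▷ (X ⊗ Xᘁ) ≫ actFst a X Xᘁ) : f = g := by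
  refine ha.hom_ext fun X => ?_
  have key (f : Z ⟶ E) : Z ◁ leftCoev X ≫ (α_ _ _ _).inv ≫ (f ▷ X ≫ a X) ▷ Xᘁ =
      Z ◁ leftCoev X ≫ f ▷ (X ⊗ Xᘁ) ≫ actFst a X Xᘁ := by simp [actFst]
  rw [eq_leftCoev_comp_leftEv (f ▷ X ≫ a X), eq_leftCoev_comp_leftEv (g ▷ X ≫ a X), key, key, h]

variable [BraidedCategory C]

lemma IsUniversalAction.hom_ext_leftEv (ha : IsUniversalAction a) {Z : C} {f g : Z ⟶ E}
    (h : ∀ X, f ▷ (Xᘁ ⊗ X) ≫ actSnd a Xᘁ X ≫ leftEv X =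
      g ▷ (Xᘁ ⊗ X) ≫ actSnd a Xᘁ X ≫ leftEv X) : f = g := by
  refine ha.hom_ext fun X => leftEv_cancel ?_
  have key (f : Z ⟶ E) : f ▷ (Xᘁ ⊗ X) ≫ actSnd a Xᘁ X ≫ leftEv X =
      (α_ _ _ _).inv ≫ (β_ Z Xᘁ).hom ▷ X ≫ (α_ _ _ _).hom ≫ Xᘁ ◁ (f ▷ X ≫ a X) ≫ leftEv X := by
    calc
      _ = (α_ _ _ _).inv ≫ (f ▷ Xᘁ ≫ (β_ E Xᘁ).hom) ▷ X ≫ (α_ _ _ _).hom ≫ Xᘁ ◁ a X ≫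
          leftEv X := by rw [actSnd_eq]; monoidal
      _ = _ := by rw [braiding_naturality_left]; monoidal
  simpa only [key, cancel_epi] using h X

end Duality

section HopfAction

open BraidedCategory

variable {C : Type u} [Category.{v} C] [MonoidalCategory C] [BraidedCategory C] {E : C}
  {a : ∀ X : C, E ⊗ X ⟶ X} {D : BPRibbonData E}

namespace IsBialgebraAction

lemma one_actFst (hD : IsBialgebraAction a D) (X Y : C) :
    D.one ▷ (X ⊗ Y) ≫ actFst a X Y = (λ_ _).hom := by
  calc
    _ = 𝟙 _ ⊗≫ (D.one ▷ X ≫ a X) ▷ Y := by rw [actFst]; monoidal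
    _ = _ := by rw [hD.one]; monoidal

lemma one_actSnd (hD : IsBialgebraAction a D) (X Y : C) :
    D.one ▷ (X ⊗ Y) ≫ actSnd a X Y = (λ_ _).hom := by
  rw [actSnd, ← whisker_exchange_assoc, ← Category.assoc (D.one ▷ _), hD.one_actFst]
  simp

end IsBialgebraAction

variable [RigidCategory C]

/-- A bialgebra action whose antipode `S` is characterised on coevaluations: acting by `S` on `X`
is the same as acting on the dual `Xᘁ`. -/
structure IsHopfAction (a : ∀ X : C, E ⊗ X ⟶ X) (D : BPRibbonData E) : Prop
    extends IsBialgebraAction a D where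
  antipode : ∀ X, E ◁ leftCoev X ≫ D.antipode ▷ (X ⊗ Xᘁ) ≫ actFst a X Xᘁ =
    E ◁ leftCoev X ≫ actSnd a X Xᘁ

namespace IsHopfAction

lemma antipode_act (hD : IsHopfAction a D) (X : C) :
    D.antipode ▷ X ≫ a X =
      𝟙 _ ⊗≫ (E ◁ leftCoev X ≫ actSnd a X Xᘁ) ▷ X ⊗≫ X ◁ leftEv X ⊗≫ 𝟙 _ := by
  have h : E ◁ leftCoev X ≫ (α_ _ _ _).inv ≫ (D.antipode ▷ X ≫ a X) ▷ Xᘁ =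
      E ◁ leftCoev X ≫ D.antipode ▷ (X ⊗ Xᘁ) ≫ actFst a X Xᘁ := by simp [actFst]
  rw [eq_leftCoev_comp_leftEv (D.antipode ▷ X ≫ a X), h, hD.antipode]

lemma antipode_actSnd_leftEv (hD : IsHopfAction a D) (X : C) :
    D.antipode ▷ (Xᘁ ⊗ X) ≫ actSnd a Xᘁ X ≫ leftEv X = actFst a Xᘁ X ≫ leftEv X := by
  calc
    _ = 𝟙 _ ⊗≫ (D.antipode ▷ Xᘁ ≫ (β_ E Xᘁ).hom) ▷ X ⊗≫ (Xᘁ : C) ◁ a X ≫ leftEv X := by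
      rw [actSnd_eq]; monoidal
    _ = 𝟙 _ ⊗≫ (β_ E Xᘁ).hom ▷ X ⊗≫ (Xᘁ : C) ◁ (D.antipode ▷ X ≫ a X) ≫ leftEv X := by
      rw [braiding_naturality_left]; monoidal
    _ = 𝟙 _ ⊗≫ ((β_ E Xᘁ).hom ▷ 𝟙_ C ≫ ((Xᘁ : C) ⊗ E) ◁ leftCoev X) ▷ X ⊗≫
          (Xᘁ : C) ◁ (β_ E X).hom ▷ (Xᘁ : C) ▷ X ⊗≫ (Xᘁ : C) ◁ X ◁ a Xᘁ ▷ X ⊗≫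
          (((Xᘁ : C) ⊗ X) ◁ leftEv X ≫ leftEv X ▷ 𝟙_ C) ⊗≫ 𝟙 _ := by
      rw [hD.antipode_act, actSnd_eq]; monoidal
    _ = 𝟙 _ ⊗≫ E ◁ (Xᘁ : C) ◁ leftCoev X ▷ X ⊗≫
          ((α_ E Xᘁ X).inv ≫ (β_ E Xᘁ).hom ▷ X ≫ (α_ Xᘁ E X).hom ≫ Xᘁ ◁ (β_ E X).hom ≫
            (α_ Xᘁ X E).inv) ▷ (Xᘁ : C) ▷ X ⊗≫
          (((Xᘁ : C) ⊗ X) ◁ a Xᘁ ≫ leftEv X ▷ Xᘁ) ▷ X ⊗≫ leftEv X := by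
      rw [← whisker_exchange, whisker_exchange (leftEv X)]; monoidal
    _ = 𝟙 _ ⊗≫ E ◁ (Xᘁ : C) ◁ leftCoev X ▷ X ⊗≫
          ((β_ E (Xᘁ ⊗ X)).hom ≫ leftEv X ▷ E) ▷ (Xᘁ : C) ▷ X ⊗≫ a Xᘁ ▷ X ⊗≫ leftEv X := by
      rw [whisker_exchange, braiding_tensor_right_hom]; monoidal
    _ = 𝟙 _ ⊗≫ E ◁ ((Xᘁ : C) ◁ leftCoev X ⊗≫ leftEv X ▷ Xᘁ) ▷ X ⊗≫ a Xᘁ ▷ X ⊗≫ leftEv X := by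
      rw [← braiding_naturality_right, braiding_tensorUnit_right]; monoidal
    _ = _ := by rw [leftEv_leftCoev, actFst]; monoidal

lemma antipode_left (ha : IsUniversalAction a) (hD : IsHopfAction a D) :
    D.comul ≫ D.antipode ▷ E ≫ D.mul = D.counit ≫ D.one := by
  refine ha.hom_ext_leftEv fun X => ?_
  calc
    _ = D.comul ▷ (Xᘁ ⊗ X) ≫ (D.antipode ▷ E) ▷ (Xᘁ ⊗ X) ≫
        (D.mul ▷ (Xᘁ ⊗ X) ≫ actSnd a Xᘁ X) ≫ leftEv X := by simp
    _ = D.comul ▷ (Xᘁ ⊗ X) ≫ (α_ _ _ _).hom ≫ (D.antipode ▷ (E ⊗ (Xᘁ ⊗ X)) ≫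
        E ◁ actSnd a Xᘁ X) ≫ actSnd a Xᘁ X ≫ leftEv X := by rw [hD.mul_actSnd]; simp
    _ = (D.comul ▷ (Xᘁ ⊗ X) ≫ actTensor a Xᘁ X) ≫ leftEv X := by
      rw [← whisker_exchange, Category.assoc, hD.antipode_actSnd_leftEv, actTensor]; simp
    _ = E ◁ leftEv X ≫ (ρ_ E).hom ≫ D.counit := by
      rw [hD.comul, ← ha.naturality, hD.counit]
    _ = D.counit ▷ (Xᘁ ⊗ X) ≫ (D.one ▷ (Xᘁ ⊗ X) ≫ actSnd a Xᘁ X) ≫ leftEv X := by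
      rw [hD.one_actSnd, ← leftUnitor_naturality, ← whisker_exchange_assoc]
      simp [unitors_equal]
    _ = _ := by simp

lemma antipode_right (ha : IsUniversalAction a) (hD : IsHopfAction a D) :
    D.comul ≫ E ◁ D.antipode ≫ D.mul = D.counit ≫ D.one := by
  refine ha.hom_ext_leftCoev fun X => ?_
  calc
    _ = E ◁ leftCoev X ≫ D.comul ▷ (X ⊗ Xᘁ) ≫ (E ◁ D.antipode) ▷ (X ⊗ Xᘁ) ≫
        (D.mul ▷ (X ⊗ Xᘁ) ≫ actFst a X Xᘁ) := by simp
    _ = D.comul ▷ (𝟙_ C) ≫ (α_ _ _ _).hom ≫ E ◁ (E ◁ leftCoev X ≫ D.antipode ▷ (X ⊗ Xᘁ) ≫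
        actFst a X Xᘁ) ≫ actFst a X Xᘁ := by
      rw [hD.mul_actFst, whisker_exchange_assoc]; simp
    _ = E ◁ leftCoev X ≫ (D.comul ▷ (X ⊗ Xᘁ) ≫ actTensor a X Xᘁ) := by
      rw [hD.antipode, actTensor, whisker_exchange_assoc]; simp
    _ = (ρ_ E).hom ≫ D.counit ≫ leftCoev X := by
      rw [hD.comul, ha.naturality, hD.counit, Category.assoc]
    _ = E ◁ leftCoev X ≫ D.counit ▷ (X ⊗ Xᘁ) ≫ (D.one ▷ (X ⊗ Xᘁ) ≫ actFst a X Xᘁ) := by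
      rw [hD.one_actFst, whisker_exchange_assoc]
      simp [unitors_equal]
    _ = _ := by simp

/-- The Hopf algebra whose product, unit, coproduct, counit and antipode are described by a
universal action. -/
abbrev hopfObj (ha : IsUniversalAction a) (hD : IsHopfAction a D) : HopfObj E where
  one := D.one
  mul := D.mul
  one_mul := hD.one_mul ha
  mul_one := hD.mul_one ha
  mul_assoc := hD.mul_assoc ha
  counit := D.counit
  comul := D.comul
  counit_comul := hD.counit_comul ha
  comul_counit := hD.comul_counit ha
  comul_assoc := hD.comul_coassoc ha
  mul_comul := hD.mul_comul ha
  one_comul := hD.one_comul ha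
  mul_counit := hD.mul_counit
  one_counit := hD.one_counit
  antipode := D.antipode
  antipode_left := hD.antipode_left ha
  antipode_right := hD.antipode_right ha

end IsHopfAction

end HopfAction

section RibbonAction

open BraidedCategory RibbonCategory

variable {C : Type u} [Category.{v} C] [MonoidalCategory C] [BraidedCategory C] [RigidCategory C]
  [RibbonCategory C] {E : C} {a : ∀ X : C, E ⊗ X ⟶ X} {D : BPRibbonData E}

lemma RibbonCategory.twist_unit : (twist (𝟙_ C)).hom = 𝟙 _ := by
  have h₁ := twist_tensor (𝟙_ C) (𝟙_ C)
  have h₂ := twist_naturality (λ_ (𝟙_ C)).hom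
  rw [h₁, braiding_tensorUnit_left, MonoidalCategory.tensorHom_def] at h₂
  have h₃ : (λ_ (𝟙_ C)).hom ≫ (twist (𝟙_ C)).hom =
      (λ_ (𝟙_ C)).hom ≫ (twist (𝟙_ C)).hom ≫ (twist (𝟙_ C)).hom := by
    rw [h₂]; monoidal
  rw [cancel_epi] at h₃
  exact ((cancel_mono (twist (𝟙_ C)).hom).1 (by rw [Category.id_comp, ← h₃])).symm

lemma RibbonCategory.leftCoev_twist (X : C) :
    leftCoev X ≫ X ◁ (twist (Xᘁ)).hom = leftCoev X ≫ (twist X).hom ▷ Xᘁ := by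
  rw [twist_dual, leftCoev_comp_rightAdjointMate]

lemma RibbonCategory.leftCoev_twist_inv (X : C) :
    leftCoev X ≫ X ◁ (twist (Xᘁ)).inv = leftCoev X ≫ (twist X).inv ▷ Xᘁ := by
  rw [← cancel_mono (X ◁ (twist (Xᘁ)).hom), Category.assoc, Category.assoc, ← whisker_exchange,
    reassoc_of% leftCoev_twist]
  simp

namespace IsRibbonAction

lemma ribbon_actSnd (hD : IsRibbonAction a D) (X Y : C) :
    D.ribbon ▷ (X ⊗ Y) ≫ actSnd a X Y = (λ_ _).hom ≫ X ◁ (twist Y).inv := by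
  have h : D.ribbon ▷ (Y ⊗ X) ≫ actFst a Y X = (λ_ _).hom ≫ (twist Y).inv ▷ X := by
    calc
      _ = 𝟙 _ ⊗≫ (D.ribbon ▷ Y ≫ a Y) ▷ X := by rw [actFst]; monoidal
      _ = _ := by rw [hD.ribbon]; monoidal
  rw [actSnd, ← whisker_exchange_assoc, reassoc_of% h, braiding_naturality_left]
  simp

lemma ribbon_antipode (ha : IsUniversalAction a) (hS : IsHopfAction a D)
    (hD : IsRibbonAction a D) :
    D.ribbon ≫ D.antipode = D.ribbon := by
  refine ha.hom_ext_leftCoev fun X => ?_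
  calc
    _ = D.ribbon ▷ 𝟙_ C ≫ E ◁ leftCoev X ≫ D.antipode ▷ (X ⊗ Xᘁ) ≫ actFst a X Xᘁ := by
      rw [← whisker_exchange_assoc]; simp
    _ = 𝟙_ C ◁ leftCoev X ≫ D.ribbon ▷ (X ⊗ Xᘁ) ≫ actSnd a X Xᘁ := by
      rw [hS.antipode, whisker_exchange_assoc]
    _ = 𝟙_ C ◁ leftCoev X ≫ (λ_ _).hom ≫ (twist X).inv ▷ Xᘁ := by
      rw [hD.ribbon_actSnd, leftUnitor_naturality_assoc, leftUnitor_naturality_assoc,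
        leftCoev_twist_inv]
    _ = 𝟙_ C ◁ leftCoev X ≫ (α_ _ _ _).inv ≫ (D.ribbon ▷ X ≫ a X) ▷ Xᘁ := by
      rw [hD.ribbon]; simp
    _ = _ := by rw [actFst]; simp

lemma ribbon_counit (hD : IsRibbonAction a D) : D.ribbon ≫ D.counit = 𝟙 (𝟙_ C) := by
  have h := hD.ribbon (𝟙_ C)
  have h' : (twist (𝟙_ C)).inv = 𝟙 _ := by
    rw [← cancel_epi (twist (𝟙_ C)).hom, Iso.hom_inv_id, twist_unit, Category.comp_id]
  rw [hD.counit, h'] at h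
  rw [← cancel_epi (ρ_ (𝟙_ C)).hom]
  simpa [unitors_equal] using h

lemma copairing_counit_left (ha : IsUniversalAction a) (hD : IsRibbonAction a D) :
    D.copairing ≫ D.counit ▷ E ≫ (λ_ E).hom = D.one := ha.hom_ext fun X => by
  simp only [comp_whiskerRight, Category.assoc]
  rw [hD.counit_whiskerRight_act, ← whisker_exchange_assoc, reassoc_of% hD.copairing, hD.one]
  simp

lemma copairing_counit_right (ha : IsUniversalAction a) (hD : IsRibbonAction a D) :
    D.copairing ≫ E ◁ D.counit ≫ (ρ_ E).hom = D.one := ha.hom_ext fun X => by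
  simp only [comp_whiskerRight, Category.assoc]
  rw [hD.whiskerLeft_counit_act, ← whisker_exchange_assoc, reassoc_of% hD.copairing, hD.one]
  simp only [braiding_inv_tensorUnit_left, braiding_inv_tensorUnit_right]
  monoidal

end IsRibbonAction

end RibbonAction

/-! ### The copairing and the coproduct -/

section TripleAction

open BraidedCategory

variable {C : Type u} [Category.{v} C] [MonoidalCategory C] [BraidedCategory C]

lemma unit_whiskerRight_braiding {A B : C} (w : 𝟙_ C ⟶ A ⊗ B) (X : C) :
    w ▷ X ≫ (α_ A B X).hom ≫ A ◁ (β_ B X).hom ≫ (α_ A X B).inv ≫ (β_ A X).hom ▷ B ≫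
      (α_ X A B).hom = (λ_ X).hom ≫ (ρ_ X).inv ≫ X ◁ w := by
  have h := braiding_naturality_left w X
  rw [braiding_tensor_left_hom, braiding_tensorUnit_left] at h
  simpa using h

lemma whiskerLeft_unit_braiding {A B : C} (w : 𝟙_ C ⟶ A ⊗ B) (Y : C) :
    Y ◁ w ≫ (α_ _ _ _).inv ≫ (β_ Y A).hom ▷ B ≫ (α_ _ _ _).hom =
      (ρ_ Y).hom ≫ (λ_ Y).inv ≫ w ▷ Y ≫ (α_ _ _ _).hom ≫ A ◁ (β_ Y B).inv := by
  have := braiding_naturality_right Y w =≫ ((α_ _ _ _).hom ≫ A ◁ (β_ Y B).inv)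
  rw [braiding_tensor_right_hom, braiding_tensorUnit_right] at this
  simpa using this

lemma double_braiding_inv_tensor (X Y T : C) :
    𝟙 _ ⊗≫ ((β_ Y X).inv ≫ (β_ X Y).inv) ▷ T ⊗≫ X ◁ (β_ T Y).inv ⊗≫
        ((β_ T X).inv ≫ (β_ X T).inv) ▷ Y ⊗≫ X ◁ (β_ T Y).hom ⊗≫ 𝟙 _ =
      (β_ (Y ⊗ T) X).inv ≫ (β_ X (Y ⊗ T)).inv := by
  calc
    _ = 𝟙 _ ⊗≫ (β_ Y X).inv ▷ T ⊗≫ ((β_ X Y).inv ▷ T ≫ (β_ T (X ⊗ Y)).inv) ⊗≫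
          (β_ X T).inv ▷ Y ⊗≫ X ◁ (β_ T Y).hom ⊗≫ 𝟙 _ := by
      rw [braiding_tensor_right_inv]; monoidal
    _ = 𝟙 _ ⊗≫ (β_ Y X).inv ▷ T ⊗≫ (β_ T (Y ⊗ X)).inv ⊗≫
          ((β_ X (T ⊗ Y)).inv ≫ X ◁ (β_ T Y).hom) ⊗≫ 𝟙 _ := by
      rw [braiding_inv_naturality_left, braiding_tensor_right_inv X]; monoidal
    _ = 𝟙 _ ⊗≫ (β_ Y X).inv ▷ T ⊗≫ Y ◁ (β_ T X).inv ⊗≫ ((β_ T Y).inv ≫ (β_ T Y).hom) ▷ X ⊗≫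
          (β_ X (Y ⊗ T)).inv ⊗≫ 𝟙 _ := by
      rw [← braiding_inv_naturality_left, braiding_tensor_right_inv T]; monoidal
    _ = _ := by rw [Iso.inv_hom_id, braiding_tensor_left_inv]; monoidal

variable {E : C} (a : ∀ X : C, E ⊗ X ⟶ X)

lemma tensorμ_actTensor_eq (X Y T : C) :
    tensorμ (E ⊗ E) E (X ⊗ Y) T ≫ (actTensor a X Y ⊗ₘ a T) =
      𝟙 _ ⊗≫ (E ⊗ E) ◁ actSnd a (X ⊗ Y) T ⊗≫ E ◁ actSnd a X Y ▷ T ⊗≫ actFst a X Y ▷ T := by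
  rw [MonoidalCategory.tensorHom_def', tensorμ, actSnd_eq a (X ⊗ Y), actTensor]
  monoidal

lemma actSnd_tensor (X Y T : C) :
    actSnd a (X ⊗ Y) T =
      𝟙 _ ⊗≫ E ◁ X ◁ (β_ T Y).inv ⊗≫ actSnd a X T ▷ Y ⊗≫ X ◁ (β_ T Y).hom ⊗≫ 𝟙 _ := by
  rw [actSnd, actSnd, braiding_tensor_right_hom, braiding_tensor_right_inv, actFst, actFst]
  monoidal

variable [RigidCategory C] [RibbonCategory C] {a} {D : BPRibbonData E}

namespace IsRibbonAction

lemma copairing_act_outer (hD : IsRibbonAction a D) (X Y T : C) :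
    D.copairing ▷ ((X ⊗ Y) ⊗ T) ⊗≫ E ◁ actSnd a (X ⊗ Y) T ⊗≫ actFst a X Y ▷ T =
      𝟙 _ ⊗≫ X ◁ (β_ T Y).inv ⊗≫ ((β_ T X).inv ≫ (β_ X T).inv) ▷ Y ⊗≫ X ◁ (β_ T Y).hom ⊗≫
        𝟙 _ := by
  calc
    _ = 𝟙 _ ⊗≫ (D.copairing ▷ (X ⊗ (Y ⊗ T)) ≫ (E ⊗ E) ◁ X ◁ (β_ T Y).inv) ⊗≫
          E ◁ actSnd a X T ▷ Y ⊗≫ ((E ⊗ X) ◁ (β_ T Y).hom ≫ a X ▷ (Y ⊗ T)) ⊗≫ 𝟙 _ := by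
      rw [actSnd_tensor, actFst]; monoidal
    _ = 𝟙 _ ⊗≫ X ◁ (β_ T Y).inv ⊗≫ (D.copairing ▷ (X ⊗ T) ≫ (α_ _ _ _).hom ≫
          E ◁ actSnd a X T ≫ actFst a X T) ▷ Y ⊗≫ X ◁ (β_ T Y).hom ⊗≫ 𝟙 _ := by
      rw [← whisker_exchange, whisker_exchange (a X), actFst]; monoidal
    _ = _ := by rw [hD.copairing_actSnd_actFst]; monoidal

lemma copairing_act_right (hD : IsRibbonAction a D) (X Y T : C) :
    D.copairing ▷ ((X ⊗ Y) ⊗ T) ⊗≫ E ◁ actSnd a (X ⊗ Y) T ⊗≫ actSnd a X Y ▷ T =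
      𝟙 _ ⊗≫ X ◁ ((β_ T Y).inv ≫ (β_ Y T).inv) ⊗≫ 𝟙 _ := by
  calc
    _ = 𝟙 _ ⊗≫ D.copairing ▷ X ▷ (Y ⊗ T) ⊗≫ E ◁ (β_ E X).hom ▷ (Y ⊗ T) ⊗≫
          ((E ⊗ X) ◁ ((β_ E Y).hom ▷ T ⊗≫ Y ◁ a T) ≫ (β_ E X).hom ▷ (Y ⊗ T)) ⊗≫
          X ◁ a Y ▷ T ⊗≫ 𝟙 _ := by
      rw [actSnd_eq, actSnd_eq, braiding_tensor_right_hom]; monoidal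
    _ = 𝟙 _ ⊗≫ (D.copairing ▷ X ≫ (α_ _ _ _).hom ≫ E ◁ (β_ E X).hom ≫ (α_ _ _ _).inv ≫
          (β_ E X).hom ▷ E ≫ (α_ _ _ _).hom) ▷ (Y ⊗ T) ⊗≫
          X ◁ (E ◁ actSnd a Y T ≫ actFst a Y T) ⊗≫ 𝟙 _ := by
      rw [whisker_exchange, actSnd_eq a Y T, actFst]; monoidal
    _ = 𝟙 _ ⊗≫ X ◁ (D.copairing ▷ (Y ⊗ T) ≫ (α_ _ _ _).hom ≫ E ◁ actSnd a Y T ≫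
          actFst a Y T) ⊗≫ 𝟙 _ := by
      rw [unit_whiskerRight_braiding]; monoidal
    _ = _ := by rw [hD.copairing_actSnd_actFst]; monoidal

lemma copairing_comul_left (ha : IsUniversalAction a) (hD : IsRibbonAction a D) :
    D.copairing ≫ D.comul ▷ E =
      D.copairing ≫ D.insertCopairing ≫ E ◁ (α_ E E E).hom ≫ (α_ E E (E ⊗ E)).inv ≫
        (E ⊗ E) ◁ D.mul := by
  refine ha.hom_ext₃ fun X Y T => ?_
  rw [comp_whiskerRight_assoc, hD.comul_act_left, hD.copairing]
  symm
  calc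
    _ = 𝟙 _ ⊗≫ D.copairing ▷ ((X ⊗ Y) ⊗ T) ⊗≫ E ◁ D.copairing ▷ E ▷ ((X ⊗ Y) ⊗ T) ⊗≫
          (E ⊗ E) ◁ (D.mul ▷ ((X ⊗ Y) ⊗ T) ≫ actSnd a (X ⊗ Y) T) ⊗≫ E ◁ actSnd a X Y ▷ T ⊗≫
          actFst a X Y ▷ T := by
      rw [tensorμ_actTensor_eq, BPRibbonData.insertCopairing]; monoidal
    _ = 𝟙 _ ⊗≫ D.copairing ▷ ((X ⊗ Y) ⊗ T) ⊗≫ E ◁ (D.copairing ▷ (E ⊗ ((X ⊗ Y) ⊗ T)) ≫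
          (E ⊗ E) ◁ actSnd a (X ⊗ Y) T) ⊗≫ E ◁ (E ◁ actSnd a (X ⊗ Y) T ⊗≫ actSnd a X Y ▷ T) ⊗≫
          actFst a X Y ▷ T := by
      rw [hD.mul_actSnd]; monoidal
    _ = 𝟙 _ ⊗≫ D.copairing ▷ ((X ⊗ Y) ⊗ T) ⊗≫ E ◁ actSnd a (X ⊗ Y) T ⊗≫
          E ◁ (D.copairing ▷ ((X ⊗ Y) ⊗ T) ⊗≫ E ◁ actSnd a (X ⊗ Y) T ⊗≫ actSnd a X Y ▷ T) ⊗≫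
          actFst a X Y ▷ T := by
      rw [← whisker_exchange]; monoidal
    _ = 𝟙 _ ⊗≫ D.copairing ▷ ((X ⊗ Y) ⊗ T) ⊗≫ E ◁ actSnd a (X ⊗ Y) T ⊗≫
          ((E ⊗ X) ◁ ((β_ T Y).inv ≫ (β_ Y T).inv) ≫ a X ▷ (Y ⊗ T)) ⊗≫ 𝟙 _ := by
      rw [hD.copairing_act_right, actFst]; monoidal
    _ = 𝟙 _ ⊗≫ (D.copairing ▷ ((X ⊗ Y) ⊗ T) ⊗≫ E ◁ actSnd a (X ⊗ Y) T ⊗≫ actFst a X Y ▷ T) ⊗≫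
          X ◁ ((β_ T Y).inv ≫ (β_ Y T).inv) ⊗≫ 𝟙 _ := by
      rw [whisker_exchange, actFst]; monoidal
    _ = 𝟙 _ ⊗≫ X ◁ (β_ T Y).inv ⊗≫ ((β_ T X).inv ≫ (β_ X T).inv) ▷ Y ⊗≫
          X ◁ ((β_ T Y).hom ≫ (β_ T Y).inv ≫ (β_ Y T).inv) ⊗≫ 𝟙 _ := by
      rw [hD.copairing_act_outer]; monoidal
    _ = _ := by
      rw [Iso.hom_inv_id_assoc, braiding_tensor_left_inv, braiding_tensor_right_inv]; monoidal

lemma copairing_comul_right (ha : IsUniversalAction a) (hD : IsRibbonAction a D) :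
    D.copairing ≫ E ◁ D.comul =
      D.copairing ≫ D.insertCopairing ≫ E ◁ (α_ E E E).hom ≫ (α_ E E (E ⊗ E)).inv ≫
        D.mul ▷ (E ⊗ E) := by
  rw [← cancel_mono (α_ E E E).inv]
  refine ha.hom_ext₃ fun X Y T => ?_
  rw [Category.assoc, comp_whiskerRight_assoc, hD.comul_act_right, ← whisker_exchange_assoc,
    reassoc_of% hD.copairing]
  symm
  calc
    _ = 𝟙 _ ⊗≫ D.copairing ▷ ((X ⊗ Y) ⊗ T) ⊗≫ E ◁ D.copairing ▷ E ▷ ((X ⊗ Y) ⊗ T) ⊗≫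
          (D.mul ▷ (E ⊗ E ⊗ ((X ⊗ Y) ⊗ T)) ≫ E ◁ (E ◁ actSnd a (X ⊗ Y) T ⊗≫
            actSnd a X Y ▷ T)) ⊗≫ actFst a X Y ▷ T := by
      rw [tensorμ_actTensor_eq, BPRibbonData.insertCopairing]; monoidal
    _ = 𝟙 _ ⊗≫ D.copairing ▷ ((X ⊗ Y) ⊗ T) ⊗≫ E ◁ (D.copairing ▷ (E ⊗ ((X ⊗ Y) ⊗ T)) ≫
          (E ⊗ E) ◁ actSnd a (X ⊗ Y) T) ⊗≫ (E ⊗ E) ◁ actSnd a X Y ▷ T ⊗≫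
          (D.mul ▷ (X ⊗ Y) ≫ actFst a X Y) ▷ T := by
      rw [← whisker_exchange]; monoidal
    _ = 𝟙 _ ⊗≫ D.copairing ▷ ((X ⊗ Y) ⊗ T) ⊗≫ E ◁ actSnd a (X ⊗ Y) T ⊗≫
          E ◁ (D.copairing ▷ (X ⊗ Y) ≫ (α_ _ _ _).hom ≫ E ◁ actSnd a X Y ≫ actFst a X Y) ▷ T ⊗≫
          actFst a X Y ▷ T := by
      rw [← whisker_exchange, hD.mul_actFst]; monoidal
    _ = 𝟙 _ ⊗≫ D.copairing ▷ ((X ⊗ Y) ⊗ T) ⊗≫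
          E ◁ (actSnd a (X ⊗ Y) T ≫ ((β_ Y X).inv ≫ (β_ X Y).inv) ▷ T) ⊗≫
          actFst a X Y ▷ T := by
      rw [hD.copairing_actSnd_actFst]; monoidal
    _ = 𝟙 _ ⊗≫ (D.copairing ▷ ((X ⊗ Y) ⊗ T) ≫ (E ⊗ E) ◁ ((β_ Y X).inv ≫ (β_ X Y).inv) ▷ T) ⊗≫
          E ◁ actSnd a (X ⊗ Y) T ⊗≫ actFst a X Y ▷ T := by
      rw [← actSnd_naturality_left]; monoidal
    _ = 𝟙 _ ⊗≫ ((β_ Y X).inv ≫ (β_ X Y).inv) ▷ T ⊗≫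
          (D.copairing ▷ ((X ⊗ Y) ⊗ T) ⊗≫ E ◁ actSnd a (X ⊗ Y) T ⊗≫ actFst a X Y ▷ T) ⊗≫ 𝟙 _ := by
      rw [← whisker_exchange]; monoidal
    _ = 𝟙 _ ⊗≫ (𝟙 (X ⊗ (Y ⊗ T)) ⊗≫ ((β_ Y X).inv ≫ (β_ X Y).inv) ▷ T ⊗≫ X ◁ (β_ T Y).inv ⊗≫
          ((β_ T X).inv ≫ (β_ X T).inv) ▷ Y ⊗≫ X ◁ (β_ T Y).hom ⊗≫ 𝟙 (X ⊗ (Y ⊗ T))) ⊗≫ 𝟙 _ := by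
      rw [hD.copairing_act_outer]; monoidal
    _ = _ := by rw [double_braiding_inv_tensor]; monoidal

end IsRibbonAction

end TripleAction

/-! ### The pivotal structure -/

section Pivotal

open BraidedCategory RibbonCategory

variable {C : Type u} [Category.{v} C] [MonoidalCategory C] [RigidCategory C] [BraidedCategory C]
  [RibbonCategory C]

lemma leftCoev_dual_pivotalInv (X : C) : leftCoev Xᘁ ≫ Xᘁ ◁ pivotalInv X = rightCoev X := by
  calc
    _ = 𝟙 _ ⊗≫ (leftCoev Xᘁ ▷ 𝟙_ C ≫ (Xᘁ ⊗ (Xᘁ : C)ᘁ) ◁ rightCoev X) ⊗≫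
          (Xᘁ : C) ◁ leftEv (Xᘁ : C) ▷ X ⊗≫ 𝟙 _ := by
      rw [pivotalInv]; monoidal
    _ = 𝟙 _ ⊗≫ rightCoev X ⊗≫ (leftCoev (Xᘁ : C) ▷ (Xᘁ : C) ⊗≫ (Xᘁ : C) ◁ leftEv (Xᘁ : C)) ▷ X ⊗≫
          𝟙 _ := by
      rw [← whisker_exchange]; monoidal
    _ = _ := by rw [leftCoev_leftEv]; monoidal

lemma leftCoev_braiding_twist (X : C) :
    leftCoev X ≫ (β_ X Xᘁ).hom ≫ (β_ Xᘁ X).hom ≫ ((twist X).hom ⊗ₘ (twist Xᘁ).hom) =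
      leftCoev X := by
  rw [← twist_tensor, twist_naturality, twist_unit, Category.id_comp]

lemma rightCoev_braiding_twist (X : C) :
    rightCoev X ≫ (β_ Xᘁ X).hom ≫ (twist X).hom ▷ Xᘁ = leftCoev X := by
  conv_rhs => rw [← leftCoev_braiding_twist X]
  rw [rightCoev, MonoidalCategory.tensorHom_def', ← braiding_naturality_left_assoc,
    ← braiding_naturality_right_assoc, reassoc_of% leftCoev_twist, braiding_naturality_left_assoc,
    Category.assoc, Category.assoc]

lemma rightCoev_dual_pivotalInv (X : C) :
    rightCoev Xᘁ ≫ pivotalInv X ▷ Xᘁ = leftCoev X := by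
  rw [rightCoev, Category.assoc, Category.assoc, whisker_exchange,
    ← braiding_naturality_right_assoc, reassoc_of% leftCoev_dual_pivotalInv]
  conv_rhs => rw [← leftCoev_braiding_twist X]
  rw [rightCoev, Category.assoc, Category.assoc, braiding_naturality_right_assoc,
    MonoidalCategory.tensorHom_def]

lemma rightAdjointMate_pivotalInv (X : C) : (pivotalInv X)ᘁ ≫ pivotalInv Xᘁ = 𝟙 (Xᘁ : C) := by
  refine leftCoev_cancel ?_
  rw [MonoidalCategory.whiskerLeft_comp, reassoc_of% leftCoev_comp_rightAdjointMate,
    ← whisker_exchange, reassoc_of% leftCoev_dual_pivotalInv, rightCoev_dual_pivotalInv,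
    MonoidalCategory.whiskerLeft_id, Category.comp_id]

lemma rightCoev_comp_rightAdjointMate {X Y : C} (f : X ⟶ Y) :
    rightCoev X ≫ Xᘁ ◁ f = rightCoev Y ≫ fᘁ ▷ Y := by
  simp only [rightCoev, Category.assoc]
  rw [← MonoidalCategory.whiskerLeft_comp, ← twist_naturality, MonoidalCategory.whiskerLeft_comp,
    ← braiding_naturality_left_assoc, ← reassoc_of% leftCoev_comp_rightAdjointMate,
    braiding_naturality_right_assoc, whisker_exchange]

lemma pivotalInv_naturality {X Y : C} (f : X ⟶ Y) :
    (fᘁ)ᘁ ≫ pivotalInv Y = pivotalInv X ≫ f := by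
  refine leftCoev_cancel ?_
  rw [MonoidalCategory.whiskerLeft_comp, reassoc_of% leftCoev_comp_rightAdjointMate,
    ← whisker_exchange, reassoc_of% leftCoev_dual_pivotalInv, MonoidalCategory.whiskerLeft_comp,
    reassoc_of% leftCoev_dual_pivotalInv, ← rightCoev_comp_rightAdjointMate]

end Pivotal

/-! ### The tautological action of `X ⊗ X*` -/

section EvAct

open BraidedCategory

variable {C : Type u} [Category.{v} C] [MonoidalCategory C] [RigidCategory C]

lemma leftCoev_tensor_dualTensorIso (X Y : C) :
    leftCoev (X ⊗ Y) ≫ (X ⊗ Y) ◁ (dualTensorIso X Y).hom =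
      leftCoev X ⊗≫ X ◁ leftCoev Y ▷ Xᘁ ⊗≫ 𝟙 _ := by
  refine (@coevaluation_comp_rightAdjointMate C _ _ (X ⊗ Y) (X ⊗ Y) ⟨Yᘁ ⊗ Xᘁ⟩ _ (𝟙 _)).trans ?_
  rw [id_whiskerRight, Category.comp_id]
  refine (ExactPairing.tensor_coevaluation).trans ?_
  simp [leftCoev, monoidalComp]

lemma dualTensorIso_leftEv (X Y : C) :
    (dualTensorIso X Y).hom ▷ (X ⊗ Y) ⊗≫ Yᘁ ◁ leftEv X ▷ Y ⊗≫ leftEv Y = leftEv (X ⊗ Y) := by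
  have h : (dualTensorIso X Y).hom ▷ (X ⊗ Y) ≫ ε_ (X ⊗ Y) (Yᘁ ⊗ Xᘁ) = leftEv (X ⊗ Y) := by
    refine (@rightAdjointMate_comp_evaluation C _ _ (X ⊗ Y) (X ⊗ Y) ⟨Yᘁ ⊗ Xᘁ⟩ _ (𝟙 _)).trans ?_
    rw [MonoidalCategory.whiskerLeft_id, Category.id_comp]
    rfl
  rw [← h, ExactPairing.tensor_evaluation, leftEv, leftEv]
  monoidal

/-- The tautological action of the internal endomorphism object `X ⊗ X*` on `X`. -/
def evAct (X : C) : (X ⊗ Xᘁ) ⊗ X ⟶ X := (α_ _ _ _).hom ≫ X ◁ leftEv X ≫ (ρ_ X).hom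

lemma whiskerRight_evAct {Z X : C} (f : Z ⟶ X ⊗ Xᘁ) : f ▷ X ≫ evAct X = uncurryDual f := rfl

lemma isFaithfulAction_evAct (X : C) : IsFaithfulAction fun _ : Unit => evAct X :=
  fun _ _ _ h => uncurryDual.injective (h ())

lemma leftCoev_actFst_uncurryDual {E : C} (j : ∀ X : C, E ⟶ X ⊗ Xᘁ) (X : C) :
    E ◁ leftCoev X ≫ actFst (fun X => uncurryDual (j X)) X Xᘁ = (ρ_ E).hom ≫ j X := by
  calc
    _ = 𝟙 _ ⊗≫ (E ◁ leftCoev X ≫ j X ▷ (X ⊗ Xᘁ)) ⊗≫ X ◁ leftEv X ▷ Xᘁ ⊗≫ 𝟙 _ := by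
      rw [actFst, uncurryDual_apply]; monoidal
    _ = 𝟙 _ ⊗≫ j X ⊗≫ X ◁ (Xᘁ ◁ leftCoev X ⊗≫ leftEv X ▷ Xᘁ) ⊗≫ 𝟙 _ := by
      rw [whisker_exchange]; monoidal
    _ = _ := by rw [leftEv_leftCoev]; monoidal

lemma uncurryDual_tensorHom_leftEv {E X : C} (j : E ⟶ X ⊗ Xᘁ) :
    uncurryDual ((j ⊗ₘ j) ⊗≫ X ◁ (leftEv X ▷ Xᘁ) ⊗≫ 𝟙 (X ⊗ Xᘁ)) =
      (α_ _ _ _).hom ≫ E ◁ uncurryDual j ≫ uncurryDual j := by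
  rw [MonoidalCategory.tensorHom_def', uncurryDual_apply, uncurryDual_apply]
  calc
    _ = 𝟙 _ ⊗≫ E ◁ j ▷ X ⊗≫ j ▷ ((X ⊗ Xᘁ) ⊗ X) ⊗≫
          X ◁ (leftEv X ▷ (Xᘁ ⊗ X) ≫ 𝟙_ C ◁ leftEv X) ⊗≫ 𝟙 _ := by monoidal
    _ = 𝟙 _ ⊗≫ E ◁ j ▷ X ⊗≫ (j ▷ (X ⊗ Xᘁ ⊗ X) ≫ (X ⊗ Xᘁ) ◁ X ◁ leftEv X) ⊗≫ X ◁ leftEv X ⊗≫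
          𝟙 _ := by
      rw [← whisker_exchange]; monoidal
    _ = _ := by rw [← whisker_exchange]; monoidal

lemma uncurryDual_tensorUnit {E : C} (j : ∀ X : C, E ⟶ X ⊗ Xᘁ) :
    uncurryDual (j (𝟙_ C)) =
      (ρ_ E).hom ≫ j (𝟙_ C) ≫ (λ_ _).hom ≫ (ρ_ _).inv ≫ leftEv (𝟙_ C) := by
  rw [uncurryDual_apply]; monoidal

variable [BraidedCategory C]

lemma hom_ext_evAct {Z X Y : C} {f g : Z ⟶ (X ⊗ Xᘁ) ⊗ (Y ⊗ Yᘁ)}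
    (h : f ▷ (X ⊗ Y) ≫ tensorμ _ _ X Y ≫ (evAct X ⊗ₘ evAct Y) =
      g ▷ (X ⊗ Y) ≫ tensorμ _ _ X Y ≫ (evAct X ⊗ₘ evAct Y)) : f = g :=
  (isFaithfulAction_evAct X).tensor (isFaithfulAction_evAct Y) fun _ => h

lemma tensorHom_evAct {E : C} (j : ∀ X : C, E ⟶ X ⊗ Xᘁ) (X Y : C) :
    (j X ⊗ₘ j Y) ▷ (X ⊗ Y) ≫ tensorμ _ _ X Y ≫ (evAct X ⊗ₘ evAct Y) =
      actTensor (fun X => uncurryDual (j X)) X Y := by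
  rw [tensorμ_natural_left_assoc, tensorHom_comp_tensorHom, whiskerRight_evAct,
    whiskerRight_evAct, actTensor_eq]

/-- Moving `X*` to the left of `Y ⊗ Y*`. -/
def dualShuffle (X Y : C) : (X ⊗ Y) ⊗ (Yᘁ ⊗ Xᘁ) ⟶ (X ⊗ Xᘁ) ⊗ (Y ⊗ Yᘁ) :=
  𝟙 _ ⊗≫ X ◁ (β_ (Y ⊗ Yᘁ) Xᘁ).hom ⊗≫ 𝟙 _

lemma dualShuffle_naturality {X Y : C} (f : X ⟶ X) (g : Y ⟶ Y) :
    (f ⊗ₘ g) ▷ (Yᘁ ⊗ Xᘁ) ≫ dualShuffle X Y = dualShuffle X Y ≫ (f ▷ Xᘁ ⊗ₘ g ▷ Yᘁ) := by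
  rw [MonoidalCategory.tensorHom_def, MonoidalCategory.tensorHom_def', dualShuffle]
  calc
    _ = 𝟙 _ ⊗≫ f ▷ (Y ⊗ (Yᘁ ⊗ Xᘁ)) ⊗≫ X ◁ (g ▷ Yᘁ ▷ Xᘁ ≫ (β_ (Y ⊗ Yᘁ) Xᘁ).hom) ⊗≫ 𝟙 _ := by
      monoidal
    _ = 𝟙 _ ⊗≫ (f ▷ ((Y ⊗ Yᘁ) ⊗ Xᘁ) ≫ X ◁ ((β_ (Y ⊗ Yᘁ) Xᘁ).hom ≫ Xᘁ ◁ g ▷ Yᘁ)) ⊗≫ 𝟙 _ := by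
      rw [braiding_naturality_left]; monoidal
    _ = _ := by rw [← whisker_exchange]; monoidal

lemma dualShuffle_evAct (X Y : C) :
    dualShuffle X Y ▷ (X ⊗ Y) ≫ tensorμ _ _ X Y ≫ (evAct X ⊗ₘ evAct Y) =
      𝟙 _ ⊗≫ (X ⊗ Y) ◁ (Yᘁ ◁ leftEv X ▷ Y ⊗≫ leftEv Y) ⊗≫ 𝟙 _ := by
  rw [MonoidalCategory.tensorHom_def, tensorμ, evAct, evAct, dualShuffle]
  calc
    _ = 𝟙 _ ⊗≫ X ◁ ((α_ _ _ _).inv ≫ (β_ (Y ⊗ Yᘁ) Xᘁ).hom ▷ X ≫ (α_ _ _ _).hom ≫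
          Xᘁ ◁ (β_ (Y ⊗ Yᘁ) X).hom ≫ (α_ _ _ _).inv) ▷ Y ⊗≫
          X ◁ leftEv X ▷ (Y ⊗ Yᘁ) ▷ Y ⊗≫ X ◁ Y ◁ leftEv Y ⊗≫ 𝟙 _ := by monoidal
    _ = 𝟙 _ ⊗≫ X ◁ ((β_ (Y ⊗ Yᘁ) (Xᘁ ⊗ X)).hom ≫ leftEv X ▷ (Y ⊗ Yᘁ)) ▷ Y ⊗≫
          X ◁ Y ◁ leftEv Y ⊗≫ 𝟙 _ := by
      rw [braiding_tensor_right_hom]; monoidal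
    _ = _ := by rw [← braiding_naturality_right, braiding_tensorUnit_right]; monoidal

lemma comp_dualTensorIso_dualShuffle {E X Y : C} (j : E ⟶ (X ⊗ Y) ⊗ (X ⊗ Y)ᘁ) :
    j ≫ (X ⊗ Y) ◁ (dualTensorIso X Y).hom ≫ dualShuffle X Y =
      j ⊗≫ (X ⊗ Y) ◁ (dualTensorIso X Y).hom ⊗≫ X ◁ (β_ (Y ⊗ Yᘁ) Xᘁ).hom ⊗≫
        𝟙 ((X ⊗ Xᘁ) ⊗ (Y ⊗ Yᘁ)) := by
  rw [dualShuffle]; monoidal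

lemma comp_dualTensorIso_dualShuffle_evAct {E X Y : C} (j : E ⟶ (X ⊗ Y) ⊗ (X ⊗ Y)ᘁ) :
    (j ≫ (X ⊗ Y) ◁ (dualTensorIso X Y).hom ≫ dualShuffle X Y) ▷ (X ⊗ Y) ≫ tensorμ _ _ X Y ≫
      (evAct X ⊗ₘ evAct Y) = uncurryDual j := by
  calc
    _ = j ▷ (X ⊗ Y) ⊗≫ (X ⊗ Y) ◁ ((dualTensorIso X Y).hom ▷ (X ⊗ Y) ⊗≫
          Yᘁ ◁ leftEv X ▷ Y ⊗≫ leftEv Y) ⊗≫ 𝟙 _ := by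
      rw [comp_whiskerRight_assoc, comp_whiskerRight_assoc, dualShuffle_evAct]; monoidal
    _ = _ := by rw [dualTensorIso_leftEv, uncurryDual_apply]; monoidal

lemma leftCoev_braiding_leftEv (X Y : C) :
    𝟙 _ ⊗≫ leftCoev X ▷ (Y ⊗ X) ⊗≫ X ◁ (β_ Xᘁ Y).hom ▷ X ⊗≫ (X ⊗ Y) ◁ leftEv X ⊗≫ 𝟙 _ =
      (β_ X Y).inv := by
  have slide : leftCoev X ▷ Y ≫ (α_ _ _ _).hom ≫ X ◁ (β_ Xᘁ Y).hom =
      (λ_ Y).hom ≫ (ρ_ Y).inv ≫ Y ◁ leftCoev X ≫ (α_ _ _ _).inv ≫ (β_ X Y).inv ▷ Xᘁ ≫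
        (α_ _ _ _).hom := by
    have := unit_whiskerRight_braiding (leftCoev X) Y =≫
      ((α_ _ _ _).inv ≫ (β_ X Y).inv ▷ Xᘁ ≫ (α_ _ _ _).hom)
    simpa using this
  calc
    _ = 𝟙 _ ⊗≫ (leftCoev X ▷ Y ≫ (α_ _ _ _).hom ≫ X ◁ (β_ Xᘁ Y).hom) ▷ X ⊗≫
          (X ⊗ Y) ◁ leftEv X ⊗≫ 𝟙 _ := by monoidal
    _ = 𝟙 _ ⊗≫ Y ◁ leftCoev X ▷ X ⊗≫ ((β_ X Y).inv ▷ (Xᘁ ⊗ X) ≫ (X ⊗ Y) ◁ leftEv X) ⊗≫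
          𝟙 _ := by
      rw [slide]; monoidal
    _ = 𝟙 _ ⊗≫ Y ◁ (leftCoev X ▷ X ⊗≫ X ◁ leftEv X) ⊗≫ (β_ X Y).inv ⊗≫ 𝟙 _ := by
      rw [← whisker_exchange]; monoidal
    _ = _ := by rw [leftCoev_leftEv]; monoidal

lemma braiding_dual_evAct (X Y : C) :
    (𝟙 ((X ⊗ Y ⊗ Xᘁ) ⊗ Yᘁ) ⊗≫ X ◁ (β_ Y Xᘁ).hom ▷ Yᘁ ⊗≫ 𝟙 ((X ⊗ Xᘁ) ⊗ (Y ⊗ Yᘁ))) ▷ (X ⊗ Y) ≫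
        tensorμ _ _ X Y ≫ (evAct X ⊗ₘ evAct Y) =
      𝟙 _ ⊗≫ X ◁ Y ◁ Xᘁ ◁ (β_ Yᘁ X).hom ▷ Y ⊗≫ X ◁ Y ◁ leftEv X ▷ (Yᘁ ⊗ Y) ⊗≫
        (X ⊗ Y) ◁ leftEv Y ⊗≫ 𝟙 _ := by
  rw [MonoidalCategory.tensorHom_def (evAct X), tensorμ, evAct, evAct, braiding_tensor_left_hom]
  calc
    _ = 𝟙 _ ⊗≫ X ◁ ((β_ Y Xᘁ).hom ▷ (Yᘁ ⊗ X) ≫ (Xᘁ ⊗ Y) ◁ (β_ Yᘁ X).hom) ▷ Y ⊗≫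
          X ◁ Xᘁ ◁ (β_ Y X).hom ▷ Yᘁ ▷ Y ⊗≫
          X ◁ (leftEv X ▷ Y ▷ (Yᘁ ⊗ Y) ≫ (𝟙_ C ⊗ Y) ◁ leftEv Y) ⊗≫ 𝟙 _ := by monoidal
    _ = 𝟙 _ ⊗≫ X ◁ Y ◁ Xᘁ ◁ (β_ Yᘁ X).hom ▷ Y ⊗≫
          X ◁ ((α_ _ _ _).inv ≫ (β_ Y Xᘁ).hom ▷ X ≫ (α_ _ _ _).hom ≫
            Xᘁ ◁ (β_ Y X).hom ≫ (α_ _ _ _).inv) ▷ (Yᘁ ⊗ Y) ⊗≫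
          (X ◁ leftEv X ▷ Y) ▷ (Yᘁ ⊗ Y) ⊗≫ (X ⊗ Y) ◁ leftEv Y ⊗≫ 𝟙 _ := by
      rw [← whisker_exchange]; monoidal
    _ = 𝟙 _ ⊗≫ X ◁ Y ◁ Xᘁ ◁ (β_ Yᘁ X).hom ▷ Y ⊗≫
          X ◁ ((β_ Y (Xᘁ ⊗ X)).hom ≫ leftEv X ▷ Y) ▷ (Yᘁ ⊗ Y) ⊗≫
          (X ⊗ Y) ◁ leftEv Y ⊗≫ 𝟙 _ := by
      rw [braiding_tensor_right_hom]; monoidal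
    _ = _ := by rw [← braiding_naturality_right, braiding_tensorUnit_right]; monoidal

lemma leftCoev_doubleBraiding_evAct (X Y : C) :
    (𝟙 (𝟙_ C) ⊗≫ (leftCoev X ⊗ₘ leftCoev Y) ⊗≫
      X ◁ (((β_ Xᘁ Y).hom ≫ (β_ Y Xᘁ).hom) ▷ Yᘁ) ⊗≫ 𝟙 ((X ⊗ Xᘁ) ⊗ (Y ⊗ Yᘁ))) ▷ (X ⊗ Y) ≫
      tensorμ _ _ X Y ≫ (evAct X ⊗ₘ evAct Y) = (λ_ _).hom ≫ (β_ Y X).inv ≫ (β_ X Y).inv := by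
  calc
    _ = 𝟙 _ ⊗≫ (leftCoev X ⊗ₘ leftCoev Y) ▷ (X ⊗ Y) ⊗≫ X ◁ (β_ Xᘁ Y).hom ▷ Yᘁ ▷ X ▷ Y ⊗≫
          ((𝟙 ((X ⊗ Y ⊗ Xᘁ) ⊗ Yᘁ) ⊗≫ X ◁ (β_ Y Xᘁ).hom ▷ Yᘁ ⊗≫
            𝟙 ((X ⊗ Xᘁ) ⊗ (Y ⊗ Yᘁ))) ▷ (X ⊗ Y) ≫ tensorμ _ _ X Y ≫ (evAct X ⊗ₘ evAct Y)) := by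
      monoidal
    _ = 𝟙 _ ⊗≫ (leftCoev X ⊗ₘ leftCoev Y) ▷ (X ⊗ Y) ⊗≫
          X ◁ ((β_ Xᘁ Y).hom ▷ (Yᘁ ⊗ X) ≫ (Y ⊗ Xᘁ) ◁ (β_ Yᘁ X).hom) ▷ Y ⊗≫
          X ◁ Y ◁ leftEv X ▷ (Yᘁ ⊗ Y) ⊗≫ (X ⊗ Y) ◁ leftEv Y ⊗≫ 𝟙 _ := by
      rw [braiding_dual_evAct]; monoidal
    _ = 𝟙 _ ⊗≫ (leftCoev X ⊗ₘ leftCoev Y) ▷ (X ⊗ Y) ⊗≫ X ◁ Xᘁ ◁ Y ◁ (β_ Yᘁ X).hom ▷ Y ⊗≫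
          ((X ◁ ((β_ Xᘁ Y).hom ▷ X ⊗≫ Y ◁ leftEv X)) ▷ (Yᘁ ⊗ Y) ≫
          (X ⊗ Y ⊗ 𝟙_ C) ◁ leftEv Y) ⊗≫ 𝟙 _ := by
      rw [← whisker_exchange]; monoidal
    _ = 𝟙 _ ⊗≫ (leftCoev X ▷ (X ⊗ Y) ≫ (X ⊗ Xᘁ) ◁ (𝟙 (X ⊗ Y) ⊗≫ leftCoev Y ▷ (X ⊗ Y) ⊗≫
            Y ◁ (β_ Yᘁ X).hom ▷ Y ⊗≫ (Y ⊗ X) ◁ leftEv Y ⊗≫ 𝟙 (Y ⊗ X))) ⊗≫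
          X ◁ ((β_ Xᘁ Y).hom ▷ X ⊗≫ Y ◁ leftEv X) ⊗≫ 𝟙 _ := by
      rw [← whisker_exchange, MonoidalCategory.tensorHom_def]; monoidal
    _ = 𝟙 _ ⊗≫ (β_ Y X).inv ⊗≫ (𝟙 (Y ⊗ X) ⊗≫ leftCoev X ▷ (Y ⊗ X) ⊗≫
          X ◁ (β_ Xᘁ Y).hom ▷ X ⊗≫ (X ⊗ Y) ◁ leftEv X ⊗≫ 𝟙 (X ⊗ Y)) := by
      rw [leftCoev_braiding_leftEv, ← whisker_exchange]; monoidal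
    _ = _ := by rw [leftCoev_braiding_leftEv]; monoidal

lemma leftCoev_doubleBraiding_dualShuffle (X Y : C) :
    (leftCoev Y ⊗≫ Y ◁ leftCoev X ▷ Yᘁ ⊗≫ 𝟙 _) ≫
      ((β_ Y X).hom ≫ (β_ X Y).hom) ▷ (Xᘁ ⊗ Yᘁ) ≫ dualShuffle Y X ≫
        (β_ (X ⊗ Xᘁ) (Y ⊗ Yᘁ)).inv =
      𝟙 (𝟙_ C) ⊗≫ (leftCoev X ⊗ₘ leftCoev Y) ⊗≫
        X ◁ (((β_ Y Xᘁ).inv ≫ (β_ Xᘁ Y).inv) ▷ Yᘁ) ⊗≫ 𝟙 ((X ⊗ Xᘁ) ⊗ (Y ⊗ Yᘁ)) := by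
  calc
    _ = 𝟙 _ ⊗≫ leftCoev Y ⊗≫ Y ◁ leftCoev X ▷ Yᘁ ⊗≫
          ((β_ Y X).hom ≫ (β_ X Y).hom) ▷ (Xᘁ ⊗ Yᘁ) ⊗≫
          Y ◁ ((β_ (X ⊗ Xᘁ) Yᘁ).hom ≫ (β_ (X ⊗ Xᘁ) Yᘁ).inv) ⊗≫
          (β_ (X ⊗ Xᘁ) Y).inv ▷ Yᘁ ⊗≫ 𝟙 _ := by
      rw [dualShuffle, braiding_tensor_right_inv]; monoidal
    _ = 𝟙 _ ⊗≫ leftCoev Y ⊗≫ Y ◁ leftCoev X ▷ Yᘁ ⊗≫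
          ((β_ Y X).hom ≫ (β_ X Y).hom ≫ (β_ X Y).inv) ▷ (Xᘁ ⊗ Yᘁ) ⊗≫
          X ◁ (β_ Xᘁ Y).inv ▷ Yᘁ ⊗≫ 𝟙 _ := by
      rw [Iso.hom_inv_id, braiding_tensor_left_inv]; monoidal
    _ = 𝟙 _ ⊗≫ leftCoev Y ⊗≫ (Y ◁ leftCoev X ≫ (α_ _ _ _).inv ≫ (β_ Y X).hom ▷ Xᘁ ≫
          (α_ _ _ _).hom) ▷ Yᘁ ⊗≫ X ◁ (β_ Xᘁ Y).inv ▷ Yᘁ ⊗≫ 𝟙 _ := by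
      rw [Iso.hom_inv_id]; monoidal
    _ = 𝟙 _ ⊗≫ (𝟙_ C ◁ leftCoev Y ≫ leftCoev X ▷ (Y ⊗ Yᘁ)) ⊗≫
          X ◁ ((β_ Y Xᘁ).inv ≫ (β_ Xᘁ Y).inv) ▷ Yᘁ ⊗≫ 𝟙 _ := by
      rw [whiskerLeft_unit_braiding]; monoidal
    _ = _ := by rw [← MonoidalCategory.tensorHom_def']

end EvAct

/-! ### The antipode of the end -/

section Antipode

open BraidedCategory RibbonCategory

variable {C : Type u} [Category.{v} C] [MonoidalCategory C] [RigidCategory C]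

lemma leftCoev_actFst_wedgeAct (W : Wedge (tensorDualFunctor C)) (X : C) :
    W.pt ◁ leftCoev X ≫ actFst (wedgeAct W) X Xᘁ = (ρ_ _).hom ≫ wedgeProj W X :=
  leftCoev_actFst_uncurryDual (wedgeProj W) X

variable [BraidedCategory C] [RibbonCategory C]

lemma RibbonCategory.twist_inv_naturality {X Y : C} (f : X ⟶ Y) :
    f ≫ (twist Y).inv = (twist X).inv ≫ f := by
  rw [Iso.comp_inv_eq, Category.assoc, twist_naturality, Iso.inv_hom_id_assoc]

section Wedge

variable (W : Wedge (tensorDualFunctor C))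

lemma wedgeProj_dual_condition {X Y : C} (f : X ⟶ Y) :
    wedgeProj W Xᘁ ≫ Xᘁ ◁ pivotalInv X ≫ Xᘁ ◁ f =
      wedgeProj W Yᘁ ≫ Yᘁ ◁ pivotalInv Y ≫ fᘁ ▷ Y := by
  rw [← MonoidalCategory.whiskerLeft_comp, ← pivotalInv_naturality,
    MonoidalCategory.whiskerLeft_comp, ← reassoc_of% wedgeProj_condition, whisker_exchange]

lemma wedgeProj_dual_dual (X : C) :
    wedgeProj W (Xᘁ : C)ᘁ ≫ (Xᘁ : C)ᘁ ◁ pivotalInv Xᘁ ≫ pivotalInv X ▷ Xᘁ = wedgeProj W X := by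
  rw [whisker_exchange, reassoc_of% wedgeProj_condition, ← MonoidalCategory.whiskerLeft_comp,
    rightAdjointMate_pivotalInv, MonoidalCategory.whiskerLeft_id, Category.comp_id]

lemma wedgeProj_twist (X : C) :
    wedgeProj W X ≫ X ◁ (twist Xᘁ).hom = wedgeProj W X ≫ (twist X).hom ▷ Xᘁ := by
  rw [twist_dual, wedgeProj_condition]

lemma leftCoev_actSnd_wedgeAct (X : C) :
    W.pt ◁ leftCoev X ≫ actSnd (wedgeAct W) X Xᘁ =
      (ρ_ _).hom ≫ wedgeProj W Xᘁ ≫ Xᘁ ◁ pivotalInv X ≫ (β_ Xᘁ X).hom ≫ (twist X).hom ▷ Xᘁ := by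
  rw [← reassoc_of% leftCoev_actFst_wedgeAct, ← reassoc_of% actFst_naturality_right,
    ← whiskerLeft_comp_assoc, leftCoev_dual_pivotalInv, ← rightCoev_braiding_twist,
    MonoidalCategory.whiskerLeft_comp, MonoidalCategory.whiskerLeft_comp, Category.assoc,
    Category.assoc, actSnd_naturality_left, actSnd]
  simp

end Wedge

variable {W : Wedge (tensorDualFunctor C)}

lemma exists_antipode (hW : IsLimit W) : ∃ S : W.pt ⟶ W.pt, ∀ X, S ≫ wedgeProj W X =
    wedgeProj W Xᘁ ≫ Xᘁ ◁ pivotalInv X ≫ (β_ Xᘁ X).hom ≫ (twist X).hom ▷ Xᘁ :=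
  exists_wedgeProj_lift hW _ fun f => by
    simp only [Category.assoc]
    rw [← comp_whiskerRight, ← twist_naturality, comp_whiskerRight,
      ← braiding_naturality_right_assoc, reassoc_of% wedgeProj_dual_condition,
      braiding_naturality_left_assoc, whisker_exchange]

lemma exists_antipodeInv (hW : IsLimit W) : ∃ S : W.pt ⟶ W.pt, ∀ X, S ≫ wedgeProj W X =
    wedgeProj W Xᘁ ≫ Xᘁ ◁ pivotalInv X ≫ (β_ X Xᘁ).inv ≫ (twist X).inv ▷ Xᘁ :=
  exists_wedgeProj_lift hW _ fun f => by
    simp only [Category.assoc]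
    rw [← comp_whiskerRight, ← twist_inv_naturality, comp_whiskerRight,
      ← braiding_inv_naturality_right_assoc, reassoc_of% wedgeProj_dual_condition,
      braiding_inv_naturality_left_assoc, whisker_exchange]

namespace IsEndStructure

variable {D : BPRibbonData W.pt}

lemma antipode_antipodeInv (hW : IsLimit W) (h : IsEndStructure (wedgeProj W) D) :
    D.antipode ≫ D.antipodeInv = 𝟙 W.pt := wedgeProj_hom_ext hW fun X => by
  rw [Category.assoc, h.antipodeInv, reassoc_of% h.antipode, ← whisker_exchange_assoc,
    ← braiding_naturality_left_assoc, reassoc_of% wedgeProj_dual_dual,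
    braiding_inv_naturality_left_assoc, Iso.hom_inv_id_assoc, reassoc_of% wedgeProj_twist,
    ← comp_whiskerRight, Iso.hom_inv_id]
  simp

lemma antipodeInv_antipode (hW : IsLimit W) (h : IsEndStructure (wedgeProj W) D) :
    D.antipodeInv ≫ D.antipode = 𝟙 W.pt := wedgeProj_hom_ext hW fun X => by
  rw [Category.assoc, h.antipode, reassoc_of% h.antipodeInv, ← whisker_exchange_assoc,
    ← braiding_inv_naturality_left_assoc, reassoc_of% wedgeProj_dual_dual,
    braiding_naturality_left_assoc, Iso.inv_hom_id_assoc, whisker_exchange,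
    ← reassoc_of% wedgeProj_twist, ← MonoidalCategory.whiskerLeft_comp, Iso.hom_inv_id]
  simp

end IsEndStructure

end Antipode

/-! ### The structure morphisms of the end -/

section EndStructure

open BraidedCategory RibbonCategory

variable {C : Type u} [Category.{v} C] [MonoidalCategory C] [RigidCategory C]
  {W : Wedge (tensorDualFunctor C)}

lemma comp_wedgeProj_eq_iff {Z X : C} {f : Z ⟶ W.pt} {g : Z ⟶ X ⊗ Xᘁ} :
    f ≫ wedgeProj W X = g ↔ f ▷ X ≫ wedgeAct W X = uncurryDual g := by
  rw [← uncurryDual.injective.eq_iff, uncurryDual_comp, wedgeAct]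

lemma unit_comp_wedgeProj_eq_iff {X : C} {p : 𝟙_ C ⟶ W.pt} {φ : X ⟶ X} :
    p ≫ wedgeProj W X = leftCoev X ≫ φ ▷ Xᘁ ↔ p ▷ X ≫ wedgeAct W X = (λ_ X).hom ≫ φ := by
  rw [comp_wedgeProj_eq_iff, uncurryDual_comp_whiskerRight, uncurryDual_leftCoev]

variable {D : BPRibbonData W.pt}

lemma mul_wedgeProj_iff {X : C} :
    D.mul ≫ wedgeProj W X =
        (wedgeProj W X ⊗ₘ wedgeProj W X) ⊗≫ X ◁ (leftEv X ▷ Xᘁ) ⊗≫ 𝟙 (X ⊗ Xᘁ) ↔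
      D.mul ▷ X ≫ wedgeAct W X = (α_ _ _ _).hom ≫ W.pt ◁ wedgeAct W X ≫ wedgeAct W X := by
  rw [comp_wedgeProj_eq_iff, uncurryDual_tensorHom_leftEv, wedgeAct]

lemma one_wedgeProj_iff {X : C} :
    D.one ≫ wedgeProj W X = leftCoev X ↔ D.one ▷ X ≫ wedgeAct W X = (λ_ X).hom := by
  rw [comp_wedgeProj_eq_iff, uncurryDual_leftCoev]

lemma counit_wedgeProj_iff :
    D.counit = wedgeProj W (𝟙_ C) ≫ (λ_ _).hom ≫ (ρ_ _).inv ≫ leftEv (𝟙_ C) ↔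
      wedgeAct W (𝟙_ C) = (ρ_ W.pt).hom ≫ D.counit := by
  rw [wedgeAct, uncurryDual_tensorUnit, cancel_epi, eq_comm]

variable [BraidedCategory C]

lemma comp_tensorHom_wedgeProj_eq_iff {Z X Y : C} {f : Z ⟶ W.pt ⊗ W.pt}
    {g : Z ⟶ (X ⊗ Xᘁ) ⊗ (Y ⊗ Yᘁ)} :
    f ≫ (wedgeProj W X ⊗ₘ wedgeProj W Y) = g ↔ f ▷ (X ⊗ Y) ≫ actTensor (wedgeAct W) X Y =
      g ▷ (X ⊗ Y) ≫ tensorμ _ _ X Y ≫ (evAct X ⊗ₘ evAct Y) := by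
  have act : (f ≫ (wedgeProj W X ⊗ₘ wedgeProj W Y)) ▷ (X ⊗ Y) ≫ tensorμ _ _ X Y ≫
      (evAct X ⊗ₘ evAct Y) = f ▷ (X ⊗ Y) ≫ actTensor (wedgeAct W) X Y := by
    rw [comp_whiskerRight_assoc, tensorHom_evAct]; rfl
  exact ⟨fun h => by rw [← act, h], fun h => hom_ext_evAct (act.trans h)⟩

lemma tensorHom_wedgeProj_hom_ext (hW : IsLimit W) {Z : C} {f g : Z ⟶ W.pt ⊗ W.pt}
    (h : ∀ X Y, f ≫ (wedgeProj W X ⊗ₘ wedgeProj W Y) = g ≫ (wedgeProj W X ⊗ₘ wedgeProj W Y)) :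
    f = g :=
  (isUniversalAction_wedgeAct hW).hom_ext₂ fun X Y => by
    rw [comp_tensorHom_wedgeProj_eq_iff.1 (h X Y), comp_tensorHom_wedgeProj_eq_iff.1 rfl]

lemma comul_wedgeProj_iff {X Y : C} :
    D.comul ≫ (wedgeProj W X ⊗ₘ wedgeProj W Y) =
        wedgeProj W (X ⊗ Y) ⊗≫ (X ⊗ Y) ◁ (dualTensorIso X Y).hom ⊗≫
          X ◁ (β_ (Y ⊗ Yᘁ) Xᘁ).hom ⊗≫ 𝟙 ((X ⊗ Xᘁ) ⊗ (Y ⊗ Yᘁ)) ↔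
      D.comul ▷ (X ⊗ Y) ≫ actTensor (wedgeAct W) X Y = wedgeAct W (X ⊗ Y) := by
  rw [comp_tensorHom_wedgeProj_eq_iff, ← comp_dualTensorIso_dualShuffle,
    comp_dualTensorIso_dualShuffle_evAct, wedgeAct]

lemma copairing_wedgeProj_iff {X Y : C} :
    D.copairing ≫ (wedgeProj W X ⊗ₘ wedgeProj W Y) =
        𝟙 (𝟙_ C) ⊗≫ (leftCoev X ⊗ₘ leftCoev Y) ⊗≫
          X ◁ (((β_ Xᘁ Y).hom ≫ (β_ Y Xᘁ).hom) ▷ Yᘁ) ⊗≫ 𝟙 ((X ⊗ Xᘁ) ⊗ (Y ⊗ Yᘁ)) ↔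
      D.copairing ▷ (X ⊗ Y) ≫ actTensor (wedgeAct W) X Y =
        (λ_ _).hom ≫ (β_ Y X).inv ≫ (β_ X Y).inv := by
  rw [comp_tensorHom_wedgeProj_eq_iff, leftCoev_doubleBraiding_evAct]

variable [RibbonCategory C]

namespace IsRibbonAction

lemma leftMul_ribbon_wedgeProj (hD : IsRibbonAction (wedgeAct W) D) (X : C) :
    D.leftMul D.ribbon ≫ wedgeProj W X = wedgeProj W X ≫ (twist X).inv ▷ Xᘁ := by
  rw [comp_wedgeProj_eq_iff, uncurryDual_comp_whiskerRight]
  exact hD.leftMul_act (hD.ribbon X)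

lemma comul_wedgeProj (hD : IsRibbonAction (wedgeAct W) D) (X Y : C) :
    D.comul ≫ (wedgeProj W X ⊗ₘ wedgeProj W Y) =
      wedgeProj W (X ⊗ Y) ≫ (X ⊗ Y) ◁ (dualTensorIso X Y).hom ≫ dualShuffle X Y := by
  rw [comul_wedgeProj_iff.2 (hD.comul X Y), comp_dualTensorIso_dualShuffle]

lemma copairingNeg_wedgeProj (hW : IsLimit W) (hD : IsRibbonAction (wedgeAct W) D) (X Y : C) :
    (D.ribbonInv ≫ D.comul ≫ (β_ W.pt W.pt).inv ≫
      (D.leftMul D.ribbon ⊗ₘ D.rightMul D.ribbon)) ≫ (wedgeProj W X ⊗ₘ wedgeProj W Y) =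
      𝟙 (𝟙_ C) ⊗≫ (leftCoev X ⊗ₘ leftCoev Y) ⊗≫
        X ◁ (((β_ Y Xᘁ).inv ≫ (β_ Xᘁ Y).inv) ▷ Yᘁ) ⊗≫ 𝟙 ((X ⊗ Xᘁ) ⊗ (Y ⊗ Yᘁ)) := by
  have twist_untwist : (twist (Y ⊗ X)).hom ≫ ((twist Y).inv ⊗ₘ (twist X).inv) =
      (β_ Y X).hom ≫ (β_ X Y).hom := by
    rw [twist_tensor, Category.assoc, Category.assoc, tensorHom_comp_tensorHom]
    simp
  simp only [Category.assoc]
  rw [← hD.ribbon_central (isUniversalAction_wedgeAct hW), tensorHom_comp_tensorHom,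
    hD.leftMul_ribbon_wedgeProj, hD.leftMul_ribbon_wedgeProj, ← tensorHom_comp_tensorHom,
    ← braiding_inv_naturality_assoc, ← braiding_inv_naturality,
    reassoc_of% hD.comul_wedgeProj,
    reassoc_of% unit_comp_wedgeProj_eq_iff.2 (hD.ribbonInv (Y ⊗ X)), ← whisker_exchange_assoc,
    reassoc_of% leftCoev_tensor_dualTensorIso,
    ← reassoc_of% (dualShuffle_naturality (twist Y).inv (twist X).inv), ← comp_whiskerRight_assoc,
    twist_untwist]
  exact leftCoev_doubleBraiding_dualShuffle X Y

end IsRibbonAction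

lemma IsUniversalAction.exists_isRibbonAction {E : C} {a : ∀ X : C, E ⊗ X ⟶ X}
    (ha : IsUniversalAction a) : ∃ D : BPRibbonData E, IsRibbonAction a D := by
  obtain ⟨mul, hmul⟩ := ha.exists_lift (fun X => (α_ _ _ _).hom ≫ E ◁ a X ≫ a X) fun f => by
    rw [tensor_whiskerLeft]
    simp only [Category.assoc, Iso.inv_hom_id_assoc]
    rw [← whiskerLeft_comp_assoc, ha.naturality f, MonoidalCategory.whiskerLeft_comp,
      Category.assoc, ha.naturality f]
  obtain ⟨one, hone⟩ := ha.exists_lift (fun X => (λ_ X).hom) fun f => leftUnitor_naturality f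
  obtain ⟨comul, hcomul⟩ := ha.exists_lift₂ (fun X Y => a (X ⊗ Y)) fun f g => ha.naturality _
  obtain ⟨ribbon, hribbon⟩ := ha.exists_lift (fun X => (λ_ X).hom ≫ (twist X).inv) fun f => by
    rw [leftUnitor_naturality_assoc, twist_inv_naturality, Category.assoc]
  obtain ⟨ribbonInv, hribbonInv⟩ :=
    ha.exists_lift (fun X => (λ_ X).hom ≫ (twist X).hom) fun f => by
      rw [leftUnitor_naturality_assoc, twist_naturality, Category.assoc]
  obtain ⟨copairing, hcopairing⟩ := ha.exists_lift₂
    (fun X Y => (λ_ _).hom ≫ (β_ Y X).inv ≫ (β_ X Y).inv) fun f g => by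
      simp only [leftUnitor_naturality_assoc, Category.assoc, braiding_inv_naturality_assoc,
        braiding_inv_naturality]
  -- `IsRibbonAction` does not constrain the antipodes and `w₋`.
  exact ⟨⟨mul, one, comul, (ρ_ E).inv ≫ a (𝟙_ C), 𝟙 E, 𝟙 E, ribbon, ribbonInv, copairing,
    copairing⟩, ⟨hmul, hone, hcomul, (Iso.hom_inv_id_assoc _ _).symm⟩, hribbon, hribbonInv,
    hcopairing⟩

lemma exists_isEndStructure (hW : IsLimit W) :
    ∃ D : BPRibbonData W.pt, IsEndStructure (wedgeProj W) D := by
  obtain ⟨D, hD⟩ := (isUniversalAction_wedgeAct hW).exists_isRibbonAction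
  obtain ⟨S, hS⟩ := exists_antipode hW
  obtain ⟨T, hT⟩ := exists_antipodeInv hW
  exact ⟨{ D with
      antipode := S
      antipodeInv := T
      copairingNeg := D.ribbonInv ≫ D.comul ≫ (β_ W.pt W.pt).inv ≫
        (D.leftMul D.ribbon ⊗ₘ D.rightMul D.ribbon) },
    { mul := fun X => mul_wedgeProj_iff.2 (hD.mul X)
      one := fun X => one_wedgeProj_iff.2 (hD.one X)
      comul := fun X Y => comul_wedgeProj_iff.2 (hD.comul X Y)
      counit := counit_wedgeProj_iff.2 hD.counit
      antipode := hS
      antipodeInv := hT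
      ribbon := fun X => unit_comp_wedgeProj_eq_iff.2 (hD.ribbon X)
      ribbonInv := fun X => unit_comp_wedgeProj_eq_iff.2 (hD.ribbonInv X)
      copairing := fun X Y => copairing_wedgeProj_iff.2 (hD.copairing X Y)
      copairingNeg := hD.copairingNeg_wedgeProj hW }⟩

namespace IsEndStructure

lemma unique (hW : IsLimit W) {D' : BPRibbonData W.pt}
    (h' : IsEndStructure (wedgeProj W) D') (h : IsEndStructure (wedgeProj W) D) : D' = D := by
  apply BPRibbonData.ext
  · exact wedgeProj_hom_ext hW fun X => by rw [h'.mul, h.mul]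
  · exact wedgeProj_hom_ext hW fun X => by rw [h'.one, h.one]
  · exact tensorHom_wedgeProj_hom_ext hW fun X Y => by rw [h'.comul, h.comul]
  · rw [h'.counit, h.counit]
  · exact wedgeProj_hom_ext hW fun X => by rw [h'.antipode, h.antipode]
  · exact wedgeProj_hom_ext hW fun X => by rw [h'.antipodeInv, h.antipodeInv]
  · exact wedgeProj_hom_ext hW fun X => by rw [h'.ribbon, h.ribbon]
  · exact wedgeProj_hom_ext hW fun X => by rw [h'.ribbonInv, h.ribbonInv]
  · exact tensorHom_wedgeProj_hom_ext hW fun X Y => by rw [h'.copairing, h.copairing]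
  · exact tensorHom_wedgeProj_hom_ext hW fun X Y => by rw [h'.copairingNeg, h.copairingNeg]

lemma isRibbonAction (h : IsEndStructure (wedgeProj W) D) : IsRibbonAction (wedgeAct W) D where
  mul X := mul_wedgeProj_iff.1 (h.mul X)
  one X := one_wedgeProj_iff.1 (h.one X)
  comul X Y := comul_wedgeProj_iff.1 (h.comul X Y)
  counit := counit_wedgeProj_iff.1 h.counit
  ribbon X := unit_comp_wedgeProj_eq_iff.1 (h.ribbon X)
  ribbonInv X := unit_comp_wedgeProj_eq_iff.1 (h.ribbonInv X)
  copairing X Y := copairing_wedgeProj_iff.1 (h.copairing X Y)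

lemma isHopfAction (h : IsEndStructure (wedgeProj W) D) : IsHopfAction (wedgeAct W) D where
  toIsBialgebraAction := h.isRibbonAction.toIsBialgebraAction
  antipode X := by
    rw [leftCoev_actSnd_wedgeAct, ← h.antipode, whisker_exchange_assoc, leftCoev_actFst_wedgeAct,
      rightUnitor_naturality_assoc]

lemma copairingNeg_eq (hW : IsLimit W) (h : IsEndStructure (wedgeProj W) D) :
    D.copairingNeg = D.ribbonInv ≫ D.comul ≫ (β_ W.pt W.pt).inv ≫
      (D.leftMul D.ribbon ⊗ₘ D.rightMul D.ribbon) :=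
  tensorHom_wedgeProj_hom_ext hW fun X Y => by
    rw [h.copairingNeg, h.isRibbonAction.copairingNeg_wedgeProj hW]

lemma isBPRibbonHopf (hW : IsLimit W) (h : IsEndStructure (wedgeProj W) D) :
    D.IsBPRibbonHopf :=
  have ha := isUniversalAction_wedgeAct hW
  have hD := h.isRibbonAction
  have hS := h.isHopfAction
  { hopf := ⟨hS.hopfObj ha, rfl, rfl, rfl, rfl, rfl⟩
    antipode_antipodeInv := h.antipode_antipodeInv hW
    antipodeInv_antipode := h.antipodeInv_antipode hW
    copairing_eq := hD.copairing_eq ha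
    copairingNeg_eq := h.copairingNeg_eq hW
    ribbon_central := hD.ribbon_central ha
    ribbon_ribbonInv := hD.ribbon_ribbonInv ha
    ribbonInv_ribbon := hD.ribbonInv_ribbon ha
    ribbon_counit := hD.ribbon_counit
    ribbon_antipode := hD.ribbon_antipode ha hS
    copairing_comul_left := hD.copairing_comul_left ha
    copairing_comul_right := hD.copairing_comul_right ha
    copairing_counit_left := hD.copairing_counit_left ha
    copairing_counit_right := hD.copairing_counit_right ha
    ribbon_comul := hD.ribbon_comul ha
    copairing_braiding := hD.copairing_braiding ha }

end IsEndStructure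

end EndStructure

theorem propositionP_general {k : Type w} [Field k] {C : Type u} [Category.{v} C]
    [Preadditive C] [Linear k C] [MonoidalCategory C] [MonoidalPreadditive C] [RigidCategory C]
    [BraidedCategory C] [RibbonCategory C] (hC : IsFiniteLinearCategory k C) :
    HasEnd (tensorDualFunctor C) ∧
    ∀ W : Wedge (tensorDualFunctor C), Nonempty (IsLimit W) →
      ∃ D : BPRibbonData W.pt,
        IsEndStructure (wedgeProj W) D ∧
        (∀ D' : BPRibbonData W.pt, IsEndStructure (wedgeProj W) D' → D' = D) ∧
        D.IsBPRibbonHopf := by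
  obtain ⟨P, hP⟩ := hC.exists_isDenseGenerator
  obtain ⟨E, a, ha⟩ := hP.exists_isUniversalAction hC.hasJointEqualizers
  refine ⟨ha.hasEnd, fun W ⟨hW⟩ => ?_⟩
  obtain ⟨D, hD⟩ := exists_isEndStructure hW
  exact ⟨D, hD, fun D' hD' => hD'.unique hW hD, hD.isBPRibbonHopf hW⟩

theorem propositionP {k : Type w} [Field k] [IsAlgClosed k]
    {C : Type u} [Category.{v} C] [Preadditive C] [Linear k C]
    [MonoidalCategory C] [MonoidalPreadditive C] [MonoidalLinear k C]
    [RigidCategory C] [BraidedCategory C] [RibbonCategory C]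
    (hC : IsUnimodularCategory k C) :
    HasEnd (tensorDualFunctor C) ∧
    ∀ W : Wedge (tensorDualFunctor C), Nonempty (IsLimit W) →
      ∃ D : BPRibbonData W.pt,
        IsEndStructure (wedgeProj W) D ∧
        (∀ D' : BPRibbonData W.pt, IsEndStructure (wedgeProj W) D' → D' = D) ∧
        D.IsBPRibbonHopf :=
  propositionP_general hC.finite
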